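/- Let $k\ge 2$ be an integer and $\alpha<0$. Consider the simple $k$-ary fragmentation with index of self-similarity $\alpha$, started from one block of mass $1$: blocks evolve independently, and a block of mass $m$ lives for an exponential time of mean $m^{-\alpha}$ and then splits into $k$ blocks of mass $m/k$ each. Let $F(t)$ be the non-increasing sequence, completed by zeros, of the masses of the blocks present at time $t$, and let $\zeta=\inf\{t\ge 0:F(t)=\mathbf 0\}$ be the (almost surely finite) extinction time. For $t<\zeta$ let $F_*(t)$ be the mass of the almost surely unique block present at time $t$ whose descendants are the last to be reduced to dust, and put $F_*(t)=0$ for $t\ge\zeta$. Let $T_0=0$, $T_{n+1}=\inf\{t\ge T_n:F_*(t)<F_*(T_n)\}$ and $$Z_n=F_*(T_n)^{\alpha}\,(\zeta-T_n),\qquad n\ge 0 .$$ Let $F_\zeta$ be the distribution function of $\zeta$ and $f_\zeta=F_\zeta'$ its continuous density on $(0,\infty)$. The transition kernel of the Markov chain $(Z_n)_{n\ge0}$ on $(0,\infty)$ is $$P(x,\mathrm dy)=\frac{e^{-x}}{f_\zeta(x)}\,f_\zeta(y)\,k\,e^{k^{\alpha}y}\,F_\zeta(y)^{k-1}\,\mathbf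 1_{\{0<y<k^{-\alpha}x\}}\,\mathrm dy .$$ Then the sequence $(Z_n)_{n\ge 0}$ is stochastically increasing: $\mathbb P(Z_m>t)\le\mathbb P(Z_n>t)$ for all $m\le n$ and $t\in\mathbb R$. As a consequence, $Z_n$ converges in law as $n\to\infty$ to a random variable $Z_\infty\sim\pi_{\mathrm{stat}}$, where $\pi_{\mathrm{stat}}$ is the unique stationary distribution on $(0,\infty)$ of $P$ (that is, the unique probability measure $\pi$ on $(0,\infty)$ with $\pi(B)=\int P(x,B)\,\pi(\mathrm dx)$ for all Borel sets $B$), and $Z_\infty$ stochastically dominates $\zeta$: $\mathbb P(\zeta>t)\le\mathbb P(Z_\infty>t)$ for all $t\in\mathbb R$. -/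

import Mathlib

open MeasureTheory ProbabilityTheory Filter Topology

/-! Simple `k`-ary fragmentation with index of self-similarity `α`.

A block is labelled by a word over `Fin k`: the initial block is `[]`, and the `k` blocks produced
by the split of the block `v` are `i :: v`, `i : Fin k`. All objects below are functions of the
family `e : List (Fin k) → ℝ` of normalised lifetimes; the randomness enters by taking for `e`
a realisation of independent standard exponential random variables. -/

namespace KAryFragmentation

noncomputable section

variable {k : ℕ}

/-- Mass of the block `v`: each split produces `k` blocks of equal masses. -/
def mass (v : List (Fin k)) : ℝ := ((k : ℝ)⁻¹) ^ v.length

/-- The lifetime of a block of mass `m` is `m ^ (-α)` times its normalised lifetime, so it is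
exponential with mean `m ^ (-α)` when the normalised lifetime is standard exponential. -/
def lifetime (α : ℝ) (e : List (Fin k) → ℝ) (v : List (Fin k)) : ℝ := mass v ^ (-α) * e v

/-- Time at which the block `v` appears, i.e. at which its parent splits. -/
def birthTime (α : ℝ) (e : List (Fin k) → ℝ) : List (Fin k) → ℝ
  | [] => 0
  | _ :: v => birthTime α e v + lifetime α e v

/-- The blocks that are present at time `t`. -/
def blocksAt (α : ℝ) (e : List (Fin k) → ℝ) (t : ℝ) : Set (List (Fin k)) :=
  {v | birthTime α e v ≤ t ∧ t < birthTime α e v + lifetime α e v}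

/-- The non-increasing sequence of the masses of the blocks in `A`, completed by zeros:
its `n`-th term (starting with `n = 0`) is the `(n + 1)`-st largest mass. -/
def rankedMasses (A : Set (List (Fin k))) (n : ℕ) : ℝ :=
  sSup {x : ℝ | 0 < x ∧ ((n + 1 : ℕ) : ℕ∞) ≤ {v | v ∈ A ∧ x ≤ mass v}.encard}

/-- The state `F(t)` of the fragmentation process started from a single block of mass one. -/
def fragmentation (α : ℝ) (e : List (Fin k) → ℝ) (t : ℝ) : ℕ → ℝ :=
  rankedMasses (blocksAt α e t)

/-- The extinction time `ζ = inf {t ≥ 0 : F(t) = 0}`. -/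
def extinctionTime (α : ℝ) (e : List (Fin k) → ℝ) : ℝ :=
  sInf {t : ℝ | 0 ≤ t ∧ fragmentation α e t = 0}

/-- The masses, at time `t + s`, of the fragments coming from the block `v` that is present
at time `t`. -/
def progeny (α : ℝ) (e : List (Fin k) → ℝ) (v : List (Fin k)) (t s : ℝ) : ℕ → ℝ :=
  rankedMasses {w | v <:+ w ∧ w ∈ blocksAt α e (t + s)}

/-- The time, counted from `t` on, after which the block `v` present at time `t` is reduced
to dust. -/
def progenyExtinctionTime (α : ℝ) (e : List (Fin k) → ℝ) (v : List (Fin k)) (t : ℝ) : ℝ :=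
  sInf {s : ℝ | 0 ≤ s ∧ progeny α e v t s = 0}

/-- Among the blocks present at time `t`, the block `v` takes longest to be reduced to dust. -/
def IsLastAt (α : ℝ) (e : List (Fin k) → ℝ) (t : ℝ) (v : List (Fin k)) : Prop :=
  v ∈ blocksAt α e t ∧
    ∀ w ∈ blocksAt α e t, progenyExtinctionTime α e w t ≤ progenyExtinctionTime α e v t

open Classical in
/-- The last fragment process `F_*`: the mass of the unique block present at time `t` that takes
longest to be reduced to dust. It is set to zero from time `ζ` on, and on the exceptional event
that this block is not uniquely defined at every time before `ζ`. -/
def lastFragment (α : ℝ) (e : List (Fin k) → ℝ) (t : ℝ) : ℝ :=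
  if h : (∀ s : ℝ, 0 ≤ s ∧ s < extinctionTime α e → ∃! v, IsLastAt α e s v) ∧
      (0 ≤ t ∧ t < extinctionTime α e) then
    mass (h.1 t h.2).choose
  else 0

/-- The successive jump times `T_0 = 0`, `T_{n+1} = inf {t ≥ T_n : F_*(t) < F_*(T_n)}` of the
last fragment process. -/
def jumpTime (α : ℝ) (e : List (Fin k) → ℝ) : ℕ → ℝ
  | 0 => 0
  | n + 1 => sInf {t : ℝ | jumpTime α e n ≤ t ∧
      lastFragment α e t < lastFragment α e (jumpTime α e n)}

/-- `Z_n = F_*(T_n) ^ α * (ζ - T_n)`. -/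
def Zseq (α : ℝ) (e : List (Fin k) → ℝ) (n : ℕ) : ℝ :=
  lastFragment α e (jumpTime α e n) ^ α * (extinctionTime α e - jumpTime α e n)

/-- The distribution function `F_ζ` of the extinction time, when the normalised lifetimes are
the random variables `E v`. -/
def extinctionCDF {Ω : Type*} [MeasurableSpace Ω] (μ : Measure Ω) (α : ℝ)
    (E : List (Fin k) → Ω → ℝ) (x : ℝ) : ℝ :=
  μ.real {ω | extinctionTime α (fun v => E v ω) ≤ x}

/-- The density `y ↦ P(x, dy) / dy` of the transition kernel of the chain `(Z_n)` on `(0, ∞)`,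
where `G` is the distribution function of the extinction time and its derivative is the
continuous density of the extinction time. -/
def transitionDensity (k : ℕ) (α : ℝ) (G : ℝ → ℝ) (x y : ℝ) : ℝ :=
  if 0 < y ∧ y < (k : ℝ) ^ (-α) * x then
    Real.exp (-x) / deriv G x * deriv G y *
      (k * Real.exp ((k : ℝ) ^ α * y) * G y ^ (k - 1))
  else 0

/-- `π` is a stationary distribution on `(0, ∞)` for the transition densities above. -/
structure IsStationaryLaw (k : ℕ) (α : ℝ) (G : ℝ → ℝ) (π : Measure ℝ) : Prop where
  isProbabilityMeasure : IsProbabilityMeasure π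
  pos : π (Set.Iic 0) = 0
  stationary : ∀ B : Set ℝ, MeasurableSet B →
    ∫⁻ x, (∫⁻ y in B, ENNReal.ofReal (transitionDensity k α G x y)) ∂π = π B

/-- The usual stochastic order between laws on the real line. -/
def StochLE (π₁ π₂ : Measure ℝ) : Prop := ∀ t : ℝ, π₁ (Set.Ioi t) ≤ π₂ (Set.Ioi t)

end

end KAryFragmentation

namespace KAryFragmentation

open Set ENNReal

/-! ### Stochastic order and monotone limits of laws -/

/-! Put `r = k ^ α < 1`. On the genealogical tree, the progeny of a block `v` is a copy of the whole
tree with time scaled by `r ^ v.length`, and `ζ` is the `height` of the tree, the supremum of all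
birth times. The last fragment follows a ray, `lastLine`, which at each split enters the child of
largest height, and `Z_n` is the height of the subtree at the `n`-th vertex of that ray (`Zseq_eq`).
So `Z_0 = ζ`, while `Z_1` is the maximum of the heights of `k` independent copies of the tree. Hence
`Z_0` is stochastically below `Z_1`.

Let `F` be the distribution function of `ζ`. The recursion `ζ = T + r * max ζ_i` says that `exp x *
F x` is the integral of `exp u * F (u / r) ^ k` over `[0, x]`, so `F` has the continuous density `f
x = F (x / r) ^ k - F x`. One more differentiation shows that the measure `ν` with density `k * exp
(r * y) * F y ^ (k - 1) * f y` gives mass `exp x * f x` to `(-∞, x / r)` (`transitionMeasure_Iio`).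
Thus `P(x, ·)` is `ν` conditioned on `(-∞, x / r)`. Raising the truncation point increases such a
law stochastically, so `P` is monotone and the inequality between `Z_0` and `Z_1` propagates to all
steps.

Every `P(x, ·)` is dominated by `ν` normalised, and `ν` is finite because `ζ` has an exponential
moment of order `r` (`lintegral_exp_height_lt_top`). The increasing tails of `Z_n` therefore
converge to the tail of a probability law, which is stationary by monotone convergence and dominates
`ζ`, the term `n = 0`. Uniqueness comes from a minorisation near `0` (`eq_of_bind_truncKernel_eq`).

Only the one-dimensional laws are needed: `map_chain_succ` shows that they are linked by `P`, by
computing the density of `Z_n` with respect to the law of `ζ`. -/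

lemma StochLE.refl (μ : Measure ℝ) : StochLE μ μ := fun _ => le_rfl

lemma StochLE.trans {μ₁ μ₂ μ₃ : Measure ℝ} (h : StochLE μ₁ μ₂) (h' : StochLE μ₂ μ₃) :
    StochLE μ₁ μ₃ := fun t => (h t).trans (h' t)

lemma eq_empty_or_univ_or_Ioi_of_isOpen_of_isUpperSet {U : Set ℝ} (hU : IsOpen U)
    (hU' : IsUpperSet U) : U = ∅ ∨ U = univ ∨ ∃ a, U = Ioi a := by
  rcases U.eq_empty_or_nonempty with h | hne
  · exact Or.inl h
  by_cases hb : BddBelow U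
  · refine Or.inr (Or.inr ⟨sInf U, ?_⟩)
    ext x
    constructor
    · intro hx
      obtain ⟨y, hyx, hy⟩ := exists_Ioc_subset_of_mem_nhds (hU.mem_nhds hx) ⟨x - 1, by simp⟩
      have hm : (y + x) / 2 ∈ U := hy ⟨by linarith, by linarith⟩
      exact (csInf_le hb hm).trans_lt (by linarith)
    · intro hx
      obtain ⟨y, hy, hyx⟩ := exists_lt_of_csInf_lt hne hx
      exact hU' hyx.le hy
  · refine Or.inr (Or.inl (eq_univ_of_forall fun x => ?_))
    obtain ⟨y, hy, hyx⟩ := not_bddBelow_iff.1 hb x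
    exact hU' hyx.le hy

lemma StochLE.measure_le_of_isOpen_of_isUpperSet {μ₁ μ₂ : Measure ℝ} [IsProbabilityMeasure μ₁]
    [IsProbabilityMeasure μ₂] (h : StochLE μ₁ μ₂) {U : Set ℝ} (hU : IsOpen U)
    (hU' : IsUpperSet U) : μ₁ U ≤ μ₂ U := by
  rcases eq_empty_or_univ_or_Ioi_of_isOpen_of_isUpperSet hU hU' with rfl | rfl | ⟨a, rfl⟩
  · simp
  · simp
  · exact h a

lemma isUpperSet_lt_of_monotone {g : ℝ → ℝ} (hg : Monotone g) (s : ℝ) :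
    IsUpperSet {x | s < g x} := fun _ _ hxy hx => lt_of_lt_of_le hx (hg hxy)

lemma lintegral_ofReal_eq_lintegral_meas_lt (μ : Measure ℝ) {g : ℝ → ℝ} (hg : Monotone g)
    (hg0 : ∀ x, 0 ≤ g x) :
    ∫⁻ x, ENNReal.ofReal (g x) ∂μ = ∫⁻ s in Ioi 0, μ {x | s < g x} :=
  lintegral_eq_lintegral_meas_lt μ (Eventually.of_forall hg0) hg.measurable.aemeasurable

/-- By the layer cake formula only the superlevel sets of `g` matter. Lower semicontinuity makes
them open, so they are trivial or open rays `Ioi a`, exactly the sets tested by `StochLE`. -/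
lemma StochLE.lintegral_le {μ₁ μ₂ : Measure ℝ} [IsProbabilityMeasure μ₁]
    [IsProbabilityMeasure μ₂] (h : StochLE μ₁ μ₂) {g : ℝ → ℝ} (hg : Monotone g)
    (hgc : LowerSemicontinuous g) (hg0 : ∀ x, 0 ≤ g x) :
    ∫⁻ x, ENNReal.ofReal (g x) ∂μ₁ ≤ ∫⁻ x, ENNReal.ofReal (g x) ∂μ₂ := by
  rw [lintegral_ofReal_eq_lintegral_meas_lt μ₁ hg hg0,
    lintegral_ofReal_eq_lintegral_meas_lt μ₂ hg hg0]
  exact lintegral_mono fun s => h.measure_le_of_isOpen_of_isUpperSet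
    (hgc.isOpen_preimage s) (isUpperSet_lt_of_monotone hg s)

/-- The same layer cake reduction; monotone convergence in the level then exchanges the supremum
with the integral. -/
lemma lintegral_eq_iSup_of_stochLE {μ : ℕ → Measure ℝ} [∀ n, IsProbabilityMeasure (μ n)]
    {π : Measure ℝ} [IsProbabilityMeasure π] (hμ : ∀ m n, m ≤ n → StochLE (μ m) (μ n))
    (hπ : ∀ t, π (Ioi t) = ⨆ n, μ n (Ioi t)) {g : ℝ → ℝ} (hg : Monotone g)
    (hgc : LowerSemicontinuous g) (hg0 : ∀ x, 0 ≤ g x) :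
    ∫⁻ x, ENNReal.ofReal (g x) ∂π = ⨆ n, ∫⁻ x, ENNReal.ofReal (g x) ∂(μ n) := by
  rw [lintegral_ofReal_eq_lintegral_meas_lt π hg hg0]
  simp_rw [fun n => lintegral_ofReal_eq_lintegral_meas_lt (μ n) hg hg0]
  rw [← lintegral_iSup]
  · refine lintegral_congr fun s => ?_
    rcases eq_empty_or_univ_or_Ioi_of_isOpen_of_isUpperSet (hgc.isOpen_preimage s)
      (isUpperSet_lt_of_monotone hg s) with h | h | ⟨a, h⟩
    · change π (g ⁻¹' Ioi s) = ⨆ n, μ n (g ⁻¹' Ioi s)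
      rw [h]; simp
    · change π (g ⁻¹' Ioi s) = ⨆ n, μ n (g ⁻¹' Ioi s)
      rw [h]; simp
    · change π (g ⁻¹' Ioi s) = ⨆ n, μ n (g ⁻¹' Ioi s)
      rw [h]; exact hπ a
  · intro n
    have : Antitone fun s => μ n {x | s < g x} :=
      fun s s' hs => measure_mono fun x hx => lt_of_le_of_lt hs hx
    exact this.measurable
  · intro m n hmn s
    exact (hμ m n hmn).measure_le_of_isOpen_of_isUpperSet (hgc.isOpen_preimage s)
      (isUpperSet_lt_of_monotone hg s)

lemma exists_lt_measure_Ioi {μ : Measure ℝ} {t : ℝ} {a : ℝ≥0∞} (h : a < μ (Ioi t)) :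
    ∃ s, t < s ∧ a < μ (Ioi s) := by
  obtain ⟨u, hu, hut, hlim⟩ := exists_seq_strictAnti_tendsto t
  have hU : Ioi t = ⋃ n, Ioi (u n) := by
    ext x
    simp only [mem_Ioi, mem_iUnion]
    exact ⟨fun hx => (hlim.eventually (gt_mem_nhds hx)).exists, fun ⟨n, hn⟩ => (hut n).trans hn⟩
  have hmono : Monotone fun n => Ioi (u n) := fun m n hmn => Ioi_subset_Ioi (hu.antitone hmn)
  rw [hU, hmono.measure_iUnion] at h
  obtain ⟨n, hn⟩ := lt_iSup_iff.1 h
  exact ⟨u n, hut n, hn⟩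

/-- A stochastically increasing tight sequence of laws has a limit law. -/
lemma exists_measure_Ioi_eq_iSup {μ : ℕ → Measure ℝ} [∀ n, IsProbabilityMeasure (μ n)]
    (htight : Tendsto (fun t => ⨆ n, μ n (Ioi t)) atTop (𝓝 0)) :
    ∃ π : Measure ℝ, IsProbabilityMeasure π ∧ ∀ t, π (Ioi t) = ⨆ n, μ n (Ioi t) := by
  set S : ℝ → ℝ≥0∞ := fun t => ⨆ n, μ n (Ioi t) with hS
  have hS1 : ∀ t, S t ≤ 1 := fun t => iSup_le fun n => prob_le_one
  have hSfin : ∀ t, S t ≠ ∞ := fun t => ((hS1 t).trans_lt one_lt_top).ne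
  have hanti : Antitone S := fun s t hst => iSup_mono fun n => measure_mono (Ioi_subset_Ioi hst)
  -- A supremum of nonincreasing right-continuous functions is right-continuous: the lower bound
  -- comes from a single nearly optimal `n`, the upper bound from monotonicity.
  have hright : ∀ t, Tendsto S (𝓝[≥] t) (𝓝 (S t)) := by
    intro t
    rw [tendsto_order]
    constructor
    · intro a ha
      obtain ⟨n, hn⟩ := lt_iSup_iff.1 ha
      obtain ⟨s, hts, hs⟩ := exists_lt_measure_Ioi hn
      filter_upwards [Ico_mem_nhdsGE hts] with u hu
      exact (hs.trans_le (measure_mono (Ioi_subset_Ioi hu.2.le))).trans_le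
        (le_iSup (fun n => μ n (Ioi u)) n)
    · intro a ha
      filter_upwards [self_mem_nhdsWithin] with u hu
      exact (hanti hu).trans_lt ha
  let F : StieltjesFunction ℝ :=
    { toFun := fun t => 1 - (S t).toReal
      mono' := fun s t hst => by
        have := (ENNReal.toReal_le_toReal (hSfin t) (hSfin s)).2 (hanti hst)
        simp only; linarith
      right_continuous' := fun t =>
        tendsto_const_nhds.sub ((ENNReal.tendsto_toReal (hSfin t)).comp (hright t)) }
  have hbot : Tendsto F atBot (𝓝 0) := by
    have hSbot : Tendsto S atBot (𝓝 1) := by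
      have h0 : Tendsto (fun t => μ 0 (Ioi t)) atBot (𝓝 1) := by
        have h1 := (tendsto_measure_Ici_atBot (μ 0)).comp (tendsto_atBot_add_const_right _ (1 : ℝ)
          tendsto_id)
        rw [measure_univ] at h1
        exact tendsto_of_tendsto_of_tendsto_of_le_of_le h1 tendsto_const_nhds
          (fun t => measure_mono (Ici_subset_Ioi.2 (lt_add_one t))) fun t => prob_le_one
      exact tendsto_of_tendsto_of_tendsto_of_le_of_le h0 tendsto_const_nhds
        (fun t => le_iSup (fun n => μ n (Ioi t)) 0) hS1
    have := tendsto_const_nhds (x := (1 : ℝ)).sub ((ENNReal.tendsto_toReal one_ne_top).comp hSbot)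
    simpa using this
  have htop : Tendsto F atTop (𝓝 1) := by
    have := tendsto_const_nhds (x := (1 : ℝ)).sub
      ((ENNReal.tendsto_toReal zero_ne_top).comp htight)
    simpa using this
  have hprob : IsProbabilityMeasure F.measure := ⟨by rw [F.measure_univ hbot htop]; simp⟩
  refine ⟨F.measure, hprob, fun t => ?_⟩
  rw [F.measure_Ioi htop]
  change ENNReal.ofReal (1 - (1 - (S t).toReal)) = S t
  rw [_root_.sub_sub_cancel, ENNReal.ofReal_toReal (hSfin t)]

/-- Pointwise convergence of the tails implies convergence in law. -/
lemma tendsto_probabilityMeasure_of_tendsto_Ioi {μ : ℕ → ProbabilityMeasure ℝ}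
    {π : ProbabilityMeasure ℝ}
    (h : ∀ t, Tendsto (fun n => (μ n : Measure ℝ) (Ioi t)) atTop (𝓝 ((π : Measure ℝ) (Ioi t)))) :
    Tendsto μ atTop (𝓝 π) := by
  -- The intervals `Ioc a b` form a π-system containing small neighbourhoods of every point. The
  -- tails converge at every `t`, so no continuity points have to be selected.
  refine (isPiSystem_Ioc (id : ℝ → ℝ) id).tendsto_probabilityMeasure_of_tendsto_of_mem
    ?_ ?_ ?_
  · rintro s ⟨a, b, -, rfl⟩
    exact measurableSet_Ioc
  · intro u hu x hx
    obtain ⟨ε, hε, hball⟩ := Metric.isOpen_iff.1 hu x hx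
    refine ⟨Ioc (x - ε / 2) (x + ε / 2), ⟨_, _, by simp; linarith, rfl⟩,
      Ioc_mem_nhds (by linarith) (by linarith), fun y hy => hball ?_⟩
    rw [Metric.mem_ball, Real.dist_eq, abs_lt]
    constructor <;> linarith [hy.1, hy.2]
  · rintro s ⟨a, b, hab, rfl⟩
    replace hab : a ≤ b := le_of_lt hab
    have key : ∀ ρ : ProbabilityMeasure ℝ, (ρ : Measure ℝ) (Ioc a b) =
        (ρ : Measure ℝ) (Ioi a) - (ρ : Measure ℝ) (Ioi b) := by
      intro ρ
      rw [← measure_sdiff (Ioi_subset_Ioi hab) measurableSet_Ioi.nullMeasurableSet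
        (measure_ne_top _ _), Ioi_sdiff_Ioi]
    have hlim : Tendsto (fun n => (μ n : Measure ℝ) (Ioc a b)) atTop
        (𝓝 ((π : Measure ℝ) (Ioc a b))) := by
      simp_rw [key]
      exact ENNReal.Tendsto.sub (h a) (h b) (Or.inl (measure_ne_top _ _))
    exact (ENNReal.tendsto_toNNReal (measure_ne_top _ _)).comp hlim

end KAryFragmentation

namespace KAryFragmentation

open Set ENNReal

/-! ### Markov chains with truncated transition laws -/

/-- The finite measure `ν` conditioned on `(-∞, c x)`. -/
noncomputable def truncKernel (ν : Measure ℝ) (c x : ℝ) : Measure ℝ :=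
  (ν (Iio (c * x)))⁻¹ • ν.restrict (Iio (c * x))

section

variable {ν : Measure ℝ} {c : ℝ}

lemma truncKernel_apply (ν : Measure ℝ) (c x : ℝ) {B : Set ℝ} (hB : MeasurableSet B) :
    truncKernel ν c x B = (ν (Iio (c * x)))⁻¹ * ν (B ∩ Iio (c * x)) := by
  rw [truncKernel, Measure.smul_apply, Measure.restrict_apply hB, smul_eq_mul]

lemma monotone_measure_inter_Iio (ν : Measure ℝ) (hc : 0 < c) (B : Set ℝ) :
    Monotone fun x => ν (B ∩ Iio (c * x)) := fun _ _ hxy =>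
  measure_mono (inter_subset_inter_right _ (Iio_subset_Iio (mul_le_mul_of_nonneg_left hxy hc.le)))

lemma measurable_truncKernel (ν : Measure ℝ) (hc : 0 < c) : Measurable (truncKernel ν c) := by
  refine Measure.measurable_of_measurable_coe _ fun B hB => ?_
  simp_rw [truncKernel_apply ν c _ hB]
  have h1 := (monotone_measure_inter_Iio ν hc univ).measurable
  simp only [univ_inter] at h1
  exact h1.inv.mul (monotone_measure_inter_Iio ν hc B).measurable

lemma truncKernel_univ [IsFiniteMeasure ν]
    (hν : ∀ s, 0 < s → ν (Iio s) ≠ 0) (hc : 0 < c) {x : ℝ} (hx : 0 < x) :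
    truncKernel ν c x univ = 1 := by
  rw [truncKernel_apply _ _ _ MeasurableSet.univ, univ_inter,
    ENNReal.inv_mul_cancel (hν _ (mul_pos hc hx)) (measure_ne_top _ _)]

lemma truncKernel_of_nonpos (hν0 : ν (Iic 0) = 0) (hc : 0 < c) {x : ℝ} (hx : x ≤ 0) :
    truncKernel ν c x = 0 := by
  have : ν (Iio (c * x)) = 0 := measure_mono_null
    (fun y hy => (le_of_lt hy).trans (mul_nonpos_of_nonneg_of_nonpos hc.le hx)) hν0
  rw [truncKernel, Measure.restrict_eq_zero.2 this, smul_zero]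

lemma truncKernel_le_one (x : ℝ) {B : Set ℝ} (hB : MeasurableSet B) :
    truncKernel ν c x B ≤ 1 := by
  rw [truncKernel_apply _ _ _ hB]
  calc _ ≤ (ν (Iio (c * x)))⁻¹ * ν (Iio (c * x)) := by gcongr; exact inter_subset_right
    _ ≤ 1 := ENNReal.inv_mul_le_one _

lemma truncKernel_ne_top (x : ℝ) {B : Set ℝ} (hB : MeasurableSet B) :
    truncKernel ν c x B ≠ ∞ := ((truncKernel_le_one x hB).trans_lt one_lt_top).ne

/-- The map `A ↦ A / (G + A)` is nondecreasing. In the application `G` is the mass up to the level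
`t` and `A` the mass between `t` and the truncation point. -/
lemma inv_mul_le_inv_mul_of_add {G A A' : ℝ≥0∞} (hA' : G + A' ≠ ∞) (hA : A ≤ A') :
    (G + A)⁻¹ * A ≤ (G + A')⁻¹ * A' := by
  rcases eq_or_ne A 0 with rfl | hA0
  · simp
  have h1 : G + A ≠ 0 := by simp [hA0]
  have h2 : G + A ≠ ∞ := ne_top_of_le_ne_top hA' (by gcongr)
  have h3 : G + A' ≠ 0 := by
    intro h; simp only [add_eq_zero] at h; exact hA0 (le_zero_iff.1 (h.2 ▸ hA))
  rw [mul_comm, mul_comm (G + A')⁻¹, ← div_eq_mul_inv, ← div_eq_mul_inv,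
    ENNReal.div_le_iff h1 h2, ← ENNReal.mul_div_right_comm,
    ENNReal.le_div_iff_mul_le (Or.inl h3) (Or.inl hA')]
  calc A * (G + A') = G * A + A * A' := by ring
    _ ≤ G * A' + A * A' := by gcongr
    _ = A' * (G + A) := by ring

/-- While the truncation point is at most `t` the tail is zero; once it has passed `t`, raising it
only adds mass above `t`. -/
lemma monotone_truncKernel_Ioi [IsFiniteMeasure ν] (hc : 0 < c) (t : ℝ) :
    Monotone fun x => truncKernel ν c x (Ioi t) := by
  intro x y hxy
  simp only
  rw [truncKernel_apply _ _ _ measurableSet_Ioi, truncKernel_apply _ _ _ measurableSet_Ioi]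
  rcases le_or_gt (c * x) t with hxt | hxt
  · have : Ioi t ∩ Iio (c * x) = ∅ := by
      ext z; simp only [mem_inter_iff, mem_Ioi, mem_Iio, mem_empty_iff_false, iff_false]
      rintro ⟨h1, h2⟩; linarith
    simp [this]
  · have hcy : c * x ≤ c * y := mul_le_mul_of_nonneg_left hxy hc.le
    have key : ∀ z, t < z → ν (Iio z) = ν (Iic t) + ν (Ioi t ∩ Iio z) := by
      intro z hz
      rw [← measure_union _ (measurableSet_Ioi.inter measurableSet_Iio)]
      · congr 1
        ext w
        simp only [mem_Iio, mem_union, mem_Iic, mem_inter_iff, mem_Ioi]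
        grind
      · rw [Set.disjoint_left]
        rintro w hw ⟨hw', -⟩
        exact (not_lt.2 (mem_Iic.1 hw)) hw'
    rw [key _ hxt, key _ (hxt.trans_le hcy)]
    refine inv_mul_le_inv_mul_of_add ?_ (monotone_measure_inter_Iio ν hc _ hxy)
    rw [← key _ (hxt.trans_le hcy)]
    exact measure_ne_top _ _

lemma monotone_toReal_truncKernel_Ioi [IsFiniteMeasure ν] (hc : 0 < c) (t : ℝ) :
    Monotone fun x => (truncKernel ν c x (Ioi t)).toReal := fun x y hxy =>
  (ENNReal.toReal_le_toReal (truncKernel_ne_top x measurableSet_Ioi)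
    (truncKernel_ne_top y measurableSet_Ioi)).2 (monotone_truncKernel_Ioi hc t hxy)

/-- A nondecreasing left-continuous function is lower semicontinuous, and left-continuity holds
because the truncation set `Iio (c * x)` is an open ray. For `x ≤ 0` the kernel is the zero measure,
so the value is the minimum. -/
lemma lowerSemicontinuous_truncKernel_Ioi [IsFiniteMeasure ν] (hν0 : ν (Iic 0) = 0)
    (hν : ∀ s, 0 < s → ν (Iio s) ≠ 0) (hc : 0 < c) (t : ℝ) :
    LowerSemicontinuous fun x => (truncKernel ν c x (Ioi t)).toReal := by
  intro x a ha
  replace ha : a < (truncKernel ν c x (Ioi t)).toReal := ha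
  rcases le_or_gt x 0 with hx | hx
  · rw [truncKernel_of_nonpos hν0 hc hx] at ha
    exact Eventually.of_forall fun y => lt_of_lt_of_le (by simpa using ha) toReal_nonneg
  obtain ⟨u, hu, hux, hlim⟩ := exists_seq_strictMono_tendsto x
  have hB : ∀ B : Set ℝ, Tendsto (fun n => ν (B ∩ Iio (c * u n))) atTop
      (𝓝 (ν (B ∩ Iio (c * x)))) := by
    intro B
    have hU : B ∩ Iio (c * x) = ⋃ n, B ∩ Iio (c * u n) := by
      rw [← inter_iUnion]
      congr 1
      ext y
      simp only [mem_Iio, mem_iUnion]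
      constructor
      · intro hy
        exact ((hlim.const_mul c).eventually (lt_mem_nhds hy)).exists
      · rintro ⟨n, hn⟩
        exact hn.trans (mul_lt_mul_of_pos_left (hux n) hc)
    rw [hU]
    refine tendsto_measure_iUnion_atTop fun m n hmn => ?_
    exact inter_subset_inter_right _ (Iio_subset_Iio
      (mul_le_mul_of_nonneg_left (hu.monotone hmn) hc.le))
  have h1 := hB univ
  simp only [univ_inter] at h1
  have hx0 := hν _ (mul_pos hc hx)
  have hT : Tendsto (fun n => truncKernel ν c (u n) (Ioi t)) atTop
      (𝓝 (truncKernel ν c x (Ioi t))) := by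
    simp_rw [truncKernel_apply _ _ _ measurableSet_Ioi]
    exact ENNReal.Tendsto.mul (tendsto_inv_iff.2 h1)
      (Or.inl (ENNReal.inv_ne_zero.2 (measure_ne_top _ _))) (hB _)
      (Or.inr (ENNReal.inv_ne_top.2 hx0))
  have hT' := (ENNReal.tendsto_toReal (truncKernel_ne_top x measurableSet_Ioi)).comp hT
  obtain ⟨n, hn⟩ := (hT'.eventually (lt_mem_nhds ha)).exists
  filter_upwards [lt_mem_nhds (hux n)] with y hy
  exact lt_of_lt_of_le hn (monotone_toReal_truncKernel_Ioi hc t hy.le)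

lemma bind_truncKernel_Ioi (hc : 0 < c) (μ : Measure ℝ) (t : ℝ) :
    μ.bind (truncKernel ν c) (Ioi t) =
      ∫⁻ x, ENNReal.ofReal (truncKernel ν c x (Ioi t)).toReal ∂μ := by
  rw [Measure.bind_apply measurableSet_Ioi (measurable_truncKernel ν hc).aemeasurable]
  exact lintegral_congr fun x => (ENNReal.ofReal_toReal
    (truncKernel_ne_top x measurableSet_Ioi)).symm

lemma bind_truncKernel_univ [IsFiniteMeasure ν]
    (hν : ∀ s, 0 < s → ν (Iio s) ≠ 0) (hc : 0 < c) {μ : Measure ℝ}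
    (hμ : μ (Iic 0) = 0) : μ.bind (truncKernel ν c) univ = μ univ := by
  rw [Measure.bind_apply MeasurableSet.univ (measurable_truncKernel ν hc).aemeasurable]
  have : ∀ᵐ x ∂μ, truncKernel ν c x univ = 1 := by
    have h : ∀ᵐ x ∂μ, x ∉ Iic (0 : ℝ) := measure_eq_zero_iff_ae_notMem.1 hμ
    filter_upwards [h] with x hx
    exact truncKernel_univ hν hc (not_le.1 hx)
  rw [lintegral_congr_ae this]
  simp

lemma StochLE.bind_truncKernel [IsFiniteMeasure ν]
    (hν0 : ν (Iic 0) = 0) (hν : ∀ s, 0 < s → ν (Iio s) ≠ 0)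
    (hc : 0 < c) {μ₁ μ₂ : Measure ℝ} [IsProbabilityMeasure μ₁] [IsProbabilityMeasure μ₂]
    (h : StochLE μ₁ μ₂) :
    StochLE (μ₁.bind (truncKernel ν c)) (μ₂.bind (truncKernel ν c)) := by
  intro t
  rw [bind_truncKernel_Ioi hc, bind_truncKernel_Ioi hc]
  exact h.lintegral_le (monotone_toReal_truncKernel_Ioi hc t)
    (lowerSemicontinuous_truncKernel_Ioi hν0 hν hc t) fun _ => toReal_nonneg

/-- All one-step laws are dominated by `ν` normalised. -/
lemma truncKernel_Ioi_le [IsFiniteMeasure ν] (hc : 0 < c) (x t : ℝ) :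
    truncKernel ν c x (Ioi t) ≤ (ν univ)⁻¹ * ν (Ioi t) := by
  -- The tail increases with the truncation point, so it is bounded by its limit as that point goes
  -- to infinity, where the truncation disappears.
  have h1 : Tendsto (fun y : ℝ => ν (Iio (c * y))) atTop (𝓝 (ν univ)) := by
    have h0 : Tendsto (fun y : ℝ => ν (Iic (c * (1 / 2) * y))) atTop (𝓝 (ν univ)) :=
      (tendsto_measure_Iic_atTop ν).comp (tendsto_id.const_mul_atTop (by positivity))
    refine tendsto_of_tendsto_of_tendsto_of_le_of_le' h0 tendsto_const_nhds ?_
      (Eventually.of_forall fun y => measure_mono (subset_univ _))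
    filter_upwards [eventually_gt_atTop 0] with y hy
    refine measure_mono (Iic_subset_Iio.2 ?_)
    have := mul_pos hc hy
    nlinarith
  rcases eq_or_ne (ν univ) 0 with h0 | h0
  · rw [Measure.measure_univ_eq_zero.1 h0]
    simp [truncKernel]
  have h2 : Tendsto (fun y => (ν (Iio (c * y)))⁻¹ * ν (Ioi t)) atTop
      (𝓝 ((ν univ)⁻¹ * ν (Ioi t))) :=
    ENNReal.Tendsto.mul_const (tendsto_inv_iff.2 h1) (Or.inr (measure_ne_top _ _))
  refine ge_of_tendsto h2 ?_
  filter_upwards [eventually_ge_atTop x] with y hy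
  refine (monotone_truncKernel_Ioi hc t hy).trans ?_
  simp only
  rw [truncKernel_apply _ _ _ measurableSet_Ioi]
  gcongr
  exact inter_subset_left

/-! ### Uniqueness of the stationary law -/

lemma bind_truncKernel_mono {μ₁ μ₂ : Measure ℝ} (hc : 0 < c) (h : μ₁ ≤ μ₂) :
    μ₁.bind (truncKernel ν c) ≤ μ₂.bind (truncKernel ν c) := by
  refine Measure.le_iff.2 fun B hB => ?_
  rw [Measure.bind_apply hB (measurable_truncKernel ν hc).aemeasurable,
    Measure.bind_apply hB (measurable_truncKernel ν hc).aemeasurable]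
  exact lintegral_mono' h le_rfl

lemma bind_truncKernel_add (μ₁ μ₂ : Measure ℝ) (hc : 0 < c) :
    (μ₁ + μ₂).bind (truncKernel ν c) =
      μ₁.bind (truncKernel ν c) + μ₂.bind (truncKernel ν c) := by
  ext B hB
  rw [Measure.add_apply, Measure.bind_apply hB (measurable_truncKernel ν hc).aemeasurable,
    Measure.bind_apply hB (measurable_truncKernel ν hc).aemeasurable,
    Measure.bind_apply hB (measurable_truncKernel ν hc).aemeasurable, lintegral_add_measure]

/-- After one step from `σ ≠ 0` the law has a uniform density with respect to `ν` near `0`. -/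
lemma exists_smul_restrict_le_bind_truncKernel [IsFiniteMeasure ν]
    (hν : ∀ s, 0 < s → ν (Iio s) ≠ 0) (hc : 0 < c)
    {σ : Measure ℝ} (hσ : σ (Ioi 0) ≠ 0) :
    ∃ s, 0 < s ∧ ∃ a : ℝ≥0∞, a ≠ 0 ∧ ∀ s' ≤ s,
      a • ν.restrict (Iio s') ≤ σ.bind (truncKernel ν c) := by
  obtain ⟨u, hu, hσu⟩ := exists_lt_measure_Ioi (pos_iff_ne_zero.2 hσ)
  have hν1 : ν univ ≠ 0 := fun h => hν 1 one_pos (measure_mono_null (subset_univ _) h)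
  -- From any `x > u` the transition law is at least `(ν univ)⁻¹ • ν` on `Iio (c * u)`, and `σ`
  -- charges `Ioi u`. All levels `s' ≤ s` are allowed so that two such bounds can later share one
  -- level.
  refine ⟨c * u, mul_pos hc hu, (ν univ)⁻¹ * σ (Ioi u),
    mul_ne_zero (ENNReal.inv_ne_zero.2 (measure_ne_top _ _)) hσu.ne', fun s' hs' => ?_⟩
  refine Measure.le_iff.2 fun B hB => ?_
  rw [Measure.bind_apply hB (measurable_truncKernel ν hc).aemeasurable, Measure.smul_apply,
    Measure.restrict_apply hB, smul_eq_mul]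
  calc (ν univ)⁻¹ * σ (Ioi u) * ν (B ∩ Iio s')
      = ∫⁻ _ in Ioi u, (ν univ)⁻¹ * ν (B ∩ Iio s') ∂σ := by
        rw [setLIntegral_const]; ring
    _ ≤ ∫⁻ x in Ioi u, truncKernel ν c x B ∂σ := by
        refine setLIntegral_mono' measurableSet_Ioi fun x hx => ?_
        rw [truncKernel_apply _ _ _ hB]
        gcongr
        · exact subset_univ _
        · exact hs'.trans (mul_le_mul_of_nonneg_left (le_of_lt hx) hc.le)
    _ ≤ ∫⁻ x, truncKernel ν c x B ∂σ := setLIntegral_le_lintegral _ _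

/-- The infimum `m` of the two laws is subinvariant, hence invariant since the kernel preserves mass
on `(0, ∞)`. If `m` is not a probability, both remainders `π₁ - m` and `π₂ - m` are nonzero, and
after one step each dominates a multiple of `ν` near `0`. Then `m` plus a nonzero measure lies below
both laws, against the definition of `m`. -/
theorem eq_of_bind_truncKernel_eq [IsFiniteMeasure ν] (hν : ∀ s, 0 < s → ν (Iio s) ≠ 0)
    (hc : 0 < c) {π₁ π₂ : Measure ℝ} [IsProbabilityMeasure π₁] [IsProbabilityMeasure π₂]
    (h₁ : π₁ (Iic 0) = 0) (h₂ : π₂ (Iic 0) = 0) (hs₁ : π₁.bind (truncKernel ν c) = π₁)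
    (hs₂ : π₂.bind (truncKernel ν c) = π₂) : π₁ = π₂ := by
  set m := π₁ ⊓ π₂ with hm
  have hm1 : m ≤ π₁ := inf_le_left
  have hm2 : m ≤ π₂ := inf_le_right
  have : IsFiniteMeasure m := isFiniteMeasure_of_le _ hm1
  have hm0 : m (Iic 0) = 0 := le_zero_iff.1 ((hm1 _).trans h₁.le)
  have hmle : m.bind (truncKernel ν c) ≤ m := le_inf
    ((bind_truncKernel_mono hc hm1).trans hs₁.le) ((bind_truncKernel_mono hc hm2).trans hs₂.le)
  have : IsFiniteMeasure (m.bind (truncKernel ν c)) := isFiniteMeasure_of_le _ hmle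
  have hmeq : m.bind (truncKernel ν c) = m :=
    Measure.eq_of_le_of_measure_univ_eq hmle (bind_truncKernel_univ hν hc hm0)
  by_cases hmu : m univ = 1
  · rw [← Measure.eq_of_le_of_measure_univ_eq hm1 (by simp [hmu]),
      ← Measure.eq_of_le_of_measure_univ_eq hm2 (by simp [hmu])]
  exfalso
  have key : ∀ π : Measure ℝ, IsProbabilityMeasure π → π (Iic 0) = 0 → m ≤ π →
      π.bind (truncKernel ν c) = π → ∃ s, 0 < s ∧ ∃ a : ℝ≥0∞, a ≠ 0 ∧ ∀ s' ≤ s,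
        m + a • ν.restrict (Iio s') ≤ π := by
    intro π hπ h0 hmπ hs
    have hsub : m + (π - m) = π := by rw [add_comm]; exact Measure.sub_add_cancel_of_le hmπ
    have hne : (π - m) (Ioi 0) ≠ 0 := by
      intro h
      have h' : (π - m) univ = 0 := by
        rw [← Iic_union_Ioi (a := (0 : ℝ))]
        refine measure_union_null (le_zero_iff.1 ?_) h
        exact (Measure.sub_le _).trans h0.le
      apply hmu
      have := congrArg (fun ρ : Measure ℝ => ρ univ) hsub
      simpa [h'] using this
    obtain ⟨s, hspos, a, ha, hle⟩ := exists_smul_restrict_le_bind_truncKernel hν hc hne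
    refine ⟨s, hspos, a, ha, fun s' hs' => ?_⟩
    calc m + a • ν.restrict (Iio s')
        ≤ m.bind (truncKernel ν c) + (π - m).bind (truncKernel ν c) := by
          rw [hmeq]; gcongr; exact hle s' hs'
      _ = π := by rw [← bind_truncKernel_add _ _ hc, hsub, hs]
  obtain ⟨s₁, hs₁pos, a₁, ha₁, hle₁⟩ := key π₁ inferInstance h₁ hm1 hs₁
  obtain ⟨s₂, hs₂pos, a₂, ha₂, hle₂⟩ := key π₂ inferInstance h₂ hm2 hs₂
  set s := min s₁ s₂
  set a := min a₁ a₂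
  have hle : m + a • ν.restrict (Iio s) ≤ m := by
    refine le_inf ((?_ : _ ≤ _).trans (hle₁ s (min_le_left _ _)))
      ((?_ : _ ≤ _).trans (hle₂ s (min_le_right _ _)))
    · gcongr; exact min_le_left _ _
    · gcongr; exact min_le_right _ _
  have hu := hle univ
  rw [Measure.add_apply, Measure.smul_apply, Measure.restrict_apply_univ, smul_eq_mul] at hu
  have hpos : a * ν (Iio s) ≠ 0 :=
    mul_ne_zero (by simp [a, ha₁, ha₂, min_eq_iff]) (hν s (lt_min hs₁pos hs₂pos))
  exact (ENNReal.lt_add_right (measure_ne_top m univ) hpos).not_ge hu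

/-- A chain with truncated transition laws whose first step is stochastically increasing is
stochastically increasing, and its laws converge to a stationary law. -/
theorem exists_stationary_of_stochLE [IsFiniteMeasure ν]
    (hν0 : ν (Iic 0) = 0) (hν : ∀ s, 0 < s → ν (Iio s) ≠ 0)
    (hc : 0 < c) {μ : ℕ → Measure ℝ} [∀ n, IsProbabilityMeasure (μ n)]
    (hμ0 : μ 0 (Iic 0) = 0) (hstep : ∀ n, μ (n + 1) = (μ n).bind (truncKernel ν c))
    (h01 : StochLE (μ 0) (μ 1)) :
    (∀ m n, m ≤ n → StochLE (μ m) (μ n)) ∧ ∃ π : Measure ℝ, IsProbabilityMeasure π ∧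
      π (Iic 0) = 0 ∧ π.bind (truncKernel ν c) = π ∧ ∀ t, π (Ioi t) = ⨆ n, μ n (Ioi t) := by
  have hsucc : ∀ n, StochLE (μ n) (μ (n + 1)) := by
    intro n
    induction n with
    | zero => exact h01
    | succ n ih =>
      rw [hstep n, hstep (n + 1)]
      exact ih.bind_truncKernel hν0 hν hc
  have hmono : ∀ m n, m ≤ n → StochLE (μ m) (μ n) := by
    intro m n hmn
    induction hmn with
    | refl => exact StochLE.refl _
    | step _ ih => exact ih.trans (hsucc _)
  refine ⟨hmono, ?_⟩
  -- The initial law is not a one-step law, so `μ n` is compared with `μ (n + 1)` first.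
  have hdom : ∀ n t, μ n (Ioi t) ≤ (ν univ)⁻¹ * ν (Ioi t) := by
    intro n t
    refine (hsucc n t).trans ?_
    rw [hstep n, Measure.bind_apply measurableSet_Ioi (measurable_truncKernel ν hc).aemeasurable]
    refine (lintegral_mono fun x => truncKernel_Ioi_le hc x t).trans ?_
    simp
  have hν1 : ν univ ≠ 0 := fun h => hν 1 one_pos (measure_mono_null (subset_univ _) h)
  have htight : Tendsto (fun t => ⨆ n, μ n (Ioi t)) atTop (𝓝 0) := by
    have h1 : Tendsto (fun t => (ν univ)⁻¹ * ν (Ioi t)) atTop (𝓝 ((ν univ)⁻¹ * 0)) := by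
      refine ENNReal.Tendsto.const_mul ?_ (Or.inr (ENNReal.inv_ne_top.2 hν1))
      have h2 := ENNReal.Tendsto.sub (tendsto_const_nhds (x := ν univ) (f := atTop))
        (tendsto_measure_Iic_atTop ν) (Or.inl (measure_ne_top ν univ))
      rw [tsub_self] at h2
      refine h2.congr fun t => ?_
      rw [← measure_compl measurableSet_Iic (measure_ne_top _ _), compl_Iic]
    rw [mul_zero] at h1
    exact tendsto_of_tendsto_of_tendsto_of_le_of_le tendsto_const_nhds h1 (fun _ => zero_le)
      fun t => iSup_le fun n => hdom n t
  obtain ⟨π, hπ, hπS⟩ := exists_measure_Ioi_eq_iSup htight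
  have hπ0 : π (Iic 0) = 0 := by
    rw [← compl_Ioi, prob_compl_eq_zero_iff measurableSet_Ioi]
    refine le_antisymm prob_le_one ?_
    rw [hπS, ← (prob_compl_eq_zero_iff (μ := μ 0) measurableSet_Ioi).1 (by rwa [compl_Ioi])]
    exact le_iSup (fun n => μ n (Ioi 0)) 0
  have hbu : π.bind (truncKernel ν c) univ = 1 := by
    rw [bind_truncKernel_univ hν hc hπ0, measure_univ]
  have : IsProbabilityMeasure (π.bind (truncKernel ν c)) := ⟨hbu⟩
  refine ⟨π, hπ, hπ0, ?_, hπS⟩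
  -- The map `x ↦ P(x, Ioi t)` is monotone and lower semicontinuous, so its integral against `π` is
  -- the supremum of its integrals against `μ n`, that is, of the tails of `μ (n + 1)`.
  have hIoi : ∀ t, π.bind (truncKernel ν c) (Ioi t) = π (Ioi t) := by
    intro t
    rw [bind_truncKernel_Ioi hc, lintegral_eq_iSup_of_stochLE hmono hπS
      (monotone_toReal_truncKernel_Ioi hc t) (lowerSemicontinuous_truncKernel_Ioi hν0 hν hc t)
      (fun _ => toReal_nonneg), hπS]
    simp_rw [← bind_truncKernel_Ioi hc, ← hstep]
    refine le_antisymm (iSup_le fun n => le_iSup (fun n => μ n (Ioi t)) (n + 1))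
      (iSup_le fun n => (hsucc n t).trans (le_iSup (fun n => μ (n + 1) (Ioi t)) n))
  refine Measure.ext_of_Iic _ _ fun t => ?_
  rw [← compl_Ioi, prob_compl_eq_one_sub measurableSet_Ioi,
    prob_compl_eq_one_sub measurableSet_Ioi, hIoi]

end

end KAryFragmentation

namespace KAryFragmentation

open Set

/-! ### The genealogical tree -/

section

variable {k : ℕ}

/-- The family of normalised lifetimes of the descendants of `v`. -/
def shift (e : List (Fin k) → ℝ) (v : List (Fin k)) : List (Fin k) → ℝ := fun w => e (w ++ v)

/-- The supremum of the birth times of all blocks. -/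
noncomputable def height (α : ℝ) (e : List (Fin k) → ℝ) : ℝ := ⨆ w, birthTime α e w

@[simp] lemma shift_nil (e : List (Fin k) → ℝ) : shift e [] = e := by
  funext w; simp [shift]

lemma shift_shift (e : List (Fin k) → ℝ) (v w : List (Fin k)) :
    shift (shift e v) w = shift e (w ++ v) := by
  funext u; simp [shift]

/-- Realisations for which the extinction time is finite. -/
structure Regular (e : List (Fin k) → ℝ) : Prop where
  pos : ∀ v, 0 < e v
  bdd : ∃ a b : ℝ, 0 ≤ a ∧ 0 ≤ b ∧ ∀ v, e v ≤ a + b * v.length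

lemma Regular.shift {e : List (Fin k) → ℝ} (he : Regular e) (v : List (Fin k)) :
    Regular (shift e v) := by
  obtain ⟨a, b, ha, hb, h⟩ := he.bdd
  refine ⟨fun w => he.pos _, a + b * v.length, b, by positivity, hb, fun w => (h _).trans ?_⟩
  simp only [List.length_append, Nat.cast_add]
  linarith

variable {α : ℝ}

lemma mass_pos (hk : 0 < k) (v : List (Fin k)) : 0 < mass v := by
  have : (0 : ℝ) < k := by exact_mod_cast hk
  unfold mass; positivity

lemma mass_le_one (hk : 0 < k) (v : List (Fin k)) : mass v ≤ 1 := by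
  have : (1 : ℝ) ≤ k := by exact_mod_cast hk
  exact pow_le_one₀ (by positivity) (inv_le_one_of_one_le₀ this)

lemma lifetime_eq (hk : 0 < k) (e : List (Fin k) → ℝ) (v : List (Fin k)) :
    lifetime α e v = ((k : ℝ) ^ α) ^ v.length * e v := by
  have : (0 : ℝ) < k := by exact_mod_cast hk
  rw [lifetime, mass, Real.rpow_neg (by positivity), ← Real.rpow_natCast,
    ← Real.rpow_natCast, ← Real.rpow_mul (by positivity), Real.inv_rpow this.le, inv_inv,
    ← Real.rpow_mul this.le, mul_comm α]

lemma lifetime_pos (hk : 0 < k) {e : List (Fin k) → ℝ} (he : Regular e) (v : List (Fin k)) :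
    0 < lifetime α e v := by
  have : (0 : ℝ) < k := by exact_mod_cast hk
  rw [lifetime_eq hk]
  exact mul_pos (by positivity) (he.pos v)

/-- Words grow at the head, so the descendants of `v` are the words `w ++ v`. Self-similarity
multiplies all their lifetimes by `r ^ v.length`. -/
lemma birthTime_append (hk : 0 < k) (e : List (Fin k) → ℝ) (v w : List (Fin k)) :
    birthTime α e (w ++ v) =
      birthTime α e v + ((k : ℝ) ^ α) ^ v.length * birthTime α (shift e v) w := by
  induction w with
  | nil => simp [birthTime]
  | cons i w ih =>
    simp only [List.cons_append, birthTime, ih, lifetime_eq hk, List.length_append, shift]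
    ring

lemma birthTime_lt_cons (hk : 0 < k) {e : List (Fin k) → ℝ} (he : Regular e)
    (i : Fin k) (v : List (Fin k)) : birthTime α e v < birthTime α e (i :: v) := by
  simpa [birthTime] using lifetime_pos hk he v

lemma birthTime_le_append (hk : 0 < k) {e : List (Fin k) → ℝ} (he : Regular e)
    (w v : List (Fin k)) : birthTime α e v ≤ birthTime α e (w ++ v) := by
  induction w with
  | nil => simp
  | cons i w ih => exact ih.trans (birthTime_lt_cons hk he i _).le

lemma birthTime_nonneg (hk : 0 < k) {e : List (Fin k) → ℝ} (he : Regular e)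
    (v : List (Fin k)) : 0 ≤ birthTime α e v := by
  simpa [birthTime] using birthTime_le_append (α := α) hk he v []

/-- A block has one ancestor in each earlier generation `m`, of lifetime at most `r ^ m * (a + b *
m)`; the bound is the sum of the full series. -/
lemma birthTime_le (hk : 0 < k) (hr : (k : ℝ) ^ α < 1) {e : List (Fin k) → ℝ} {a b : ℝ}
    (ha : 0 ≤ a) (hb : 0 ≤ b) (h : ∀ v, e v ≤ a + b * v.length) (v : List (Fin k)) :
    birthTime α e v ≤
      a * (1 - (k : ℝ) ^ α)⁻¹ + b * ((k : ℝ) ^ α / (1 - (k : ℝ) ^ α) ^ 2) := by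
  have hk' : (0 : ℝ) < k := by exact_mod_cast hk
  set r := (k : ℝ) ^ α
  have hr0 : 0 < r := by positivity
  have h1 : birthTime α e v ≤ ∑ m ∈ Finset.range v.length, (a * r ^ m + b * (m * r ^ m)) := by
    induction v with
    | nil => simp [birthTime]
    | cons i v ih =>
      rw [List.length_cons, Finset.sum_range_succ, birthTime, lifetime_eq hk]
      have := mul_le_mul_of_nonneg_left (h v) (pow_nonneg hr0.le v.length)
      have e1 : r ^ v.length * (a + b * v.length) =
        a * r ^ v.length + b * (v.length * r ^ v.length) := by ring
      rw [e1] at this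
      exact add_le_add ih this
  have hS1 := hasSum_geometric_of_lt_one hr0.le hr
  have hS2 := hasSum_coe_mul_geometric_of_norm_lt_one (r := r)
    (by rwa [Real.norm_eq_abs, abs_of_pos hr0])
  have hS := (hS1.mul_left a).add (hS2.mul_left b)
  exact h1.trans (sum_le_hasSum _ (fun m _ => by positivity) hS)

lemma bddAbove_birthTime (hk : 0 < k) (hr : (k : ℝ) ^ α < 1) {e : List (Fin k) → ℝ}
    (he : Regular e) : BddAbove (range (birthTime α e)) := by
  obtain ⟨a, b, ha, hb, h⟩ := he.bdd
  exact ⟨_, by rintro _ ⟨v, rfl⟩; exact birthTime_le hk hr ha hb h v⟩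

lemma birthTime_le_height (hk : 0 < k) (hr : (k : ℝ) ^ α < 1) {e : List (Fin k) → ℝ}
    (he : Regular e) (v : List (Fin k)) : birthTime α e v ≤ height α e :=
  le_ciSup (bddAbove_birthTime hk hr he) v

/-- The time at which the progeny of `v` is extinct. -/
noncomputable def deathTime (α : ℝ) (e : List (Fin k) → ℝ) (v : List (Fin k)) : ℝ :=
  birthTime α e v + ((k : ℝ) ^ α) ^ v.length * height α (shift e v)

lemma deathTime_nil (e : List (Fin k) → ℝ) : deathTime α e [] = height α e := by
  simp [deathTime, birthTime]

lemma birthTime_append_le_deathTime (hk : 0 < k) (hr : (k : ℝ) ^ α < 1) {e : List (Fin k) → ℝ}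
    (he : Regular e) (w v : List (Fin k)) : birthTime α e (w ++ v) ≤ deathTime α e v := by
  rw [birthTime_append hk, deathTime]
  have := birthTime_le_height hk hr (he.shift v) w
  gcongr

lemma exists_lt_birthTime_append (hk : 0 < k) {e : List (Fin k) → ℝ} {v : List (Fin k)} {t : ℝ}
    (ht : t < deathTime α e v) : ∃ w, t < birthTime α e (w ++ v) := by
  have hk' : (0 : ℝ) < k := by exact_mod_cast hk
  have hr0 : 0 < ((k : ℝ) ^ α) ^ v.length := by positivity
  have h1 : (t - birthTime α e v) / ((k : ℝ) ^ α) ^ v.length < height α (shift e v) := by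
    rw [div_lt_iff₀ hr0]; unfold deathTime at ht; linarith
  obtain ⟨w, hw⟩ := exists_lt_of_lt_ciSup h1
  refine ⟨w, ?_⟩
  rw [div_lt_iff₀ hr0] at hw
  rw [birthTime_append hk]; linarith

lemma birthTime_lt_deathTime (hk : 0 < k) (hr : (k : ℝ) ^ α < 1) {e : List (Fin k) → ℝ}
    (he : Regular e) (v : List (Fin k)) : birthTime α e v < deathTime α e v :=
  (birthTime_lt_cons hk he ⟨0, hk⟩ v).trans_le (birthTime_append_le_deathTime hk hr he [⟨0, hk⟩] v)

lemma height_pos (hk : 0 < k) (hr : (k : ℝ) ^ α < 1) {e : List (Fin k) → ℝ}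
    (he : Regular e) : 0 < height α e := by
  simpa [deathTime_nil, birthTime] using birthTime_lt_deathTime hk hr he []

lemma deathTime_append_le (hk : 0 < k) (hr : (k : ℝ) ^ α < 1) {e : List (Fin k) → ℝ}
    (he : Regular e) (w v : List (Fin k)) : deathTime α e (w ++ v) ≤ deathTime α e v := by
  refine le_of_forall_lt fun t ht => ?_
  obtain ⟨u, hu⟩ := exists_lt_birthTime_append hk ht
  rw [← List.append_assoc] at hu
  exact hu.trans_le (birthTime_append_le_deathTime hk hr he _ v)

/-- Every strict descendant of `v` descends from a child, so the supremum splits into a maximum of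
finitely many suprema. -/
lemma exists_deathTime_cons_eq (hk : 0 < k) (hr : (k : ℝ) ^ α < 1) {e : List (Fin k) → ℝ}
    (he : Regular e) (v : List (Fin k)) :
    ∃ i : Fin k, deathTime α e (i :: v) = deathTime α e v := by
  have : Nonempty (Fin k) := ⟨⟨0, hk⟩⟩
  obtain ⟨i, hi⟩ := Finite.exists_max fun i => deathTime α e (i :: v)
  refine ⟨i, le_antisymm (deathTime_append_le hk hr he [i] v) (le_of_forall_lt fun t ht => ?_)⟩
  obtain ⟨w, hw⟩ := exists_lt_birthTime_append hk ht
  rcases List.eq_nil_or_concat w with rfl | ⟨w', j, rfl⟩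
  · refine hw.trans (lt_of_lt_of_le ?_ (birthTime_append_le_deathTime hk hr he [] (i :: v)))
    exact birthTime_lt_cons hk he i v
  · rw [List.concat_eq_append, List.append_assoc] at hw
    exact (hw.trans_le (birthTime_append_le_deathTime hk hr he w' (j :: v))).trans_le (hi j)

/-- Some descendant of `v` is born after `t`. Going back along its ancestry towards `v`, the first
block born by time `t` is present at `t`. -/
lemma exists_mem_blocksAt (hk : 0 < k) {e : List (Fin k) → ℝ} {v : List (Fin k)} {t : ℝ}
    (hv : birthTime α e v ≤ t) (ht : t < deathTime α e v) :
    ∃ w, v <:+ w ∧ w ∈ blocksAt α e t := by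
  obtain ⟨u, hu⟩ := exists_lt_birthTime_append hk ht
  clear ht
  induction u with
  | nil => exact absurd hu (not_lt.2 hv)
  | cons i u ih =>
    by_cases h : t < birthTime α e (u ++ v)
    · exact ih h
    · exact ⟨u ++ v, List.suffix_append _ _, not_lt.1 h, hu⟩

lemma lt_deathTime_of_mem_blocksAt (hk : 0 < k) (hr : (k : ℝ) ^ α < 1) {e : List (Fin k) → ℝ}
    (he : Regular e) {v w : List (Fin k)} {t : ℝ} (hvw : v <:+ w) (hw : w ∈ blocksAt α e t) :
    t < deathTime α e v := by
  obtain ⟨u, rfl⟩ := hvw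
  exact hw.2.trans_le (birthTime_append_le_deathTime hk hr he (⟨0, hk⟩ :: u) v)

/-! ### Extinction times read on the tree -/

lemma rankedMasses_eq_zero_iff (hk : 0 < k) (A : Set (List (Fin k))) :
    rankedMasses A = 0 ↔ A = ∅ := by
  constructor
  · intro h
    by_contra hA
    obtain ⟨v, hv⟩ := nonempty_iff_ne_empty.2 hA
    have h0 : rankedMasses A 0 = 0 := by rw [h]; rfl
    have hle : mass v ≤ rankedMasses A 0 := by
      -- The bound `1` on all masses matters: `sSup` of an unbounded set of reals would be `0` by
      -- default.
      refine le_csSup ⟨1, ?_⟩ ⟨mass_pos hk v, ?_⟩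
      · rintro x ⟨-, hx⟩
        have : {w | w ∈ A ∧ x ≤ mass w}.Nonempty := by
          rw [← Set.one_le_encard_iff_nonempty]
          simpa using hx
        obtain ⟨w, -, hw⟩ := this
        exact hw.trans (mass_le_one hk w)
      · have : {w | w ∈ A ∧ mass v ≤ mass w}.Nonempty := ⟨v, hv, le_rfl⟩
        rw [← Set.one_le_encard_iff_nonempty] at this
        simpa using this
    exact absurd (h0 ▸ hle) (not_le.2 (mass_pos hk v))
  · rintro rfl
    funext n
    simp [rankedMasses]

lemma progenyExtinctionTime_eq (hk : 0 < k) (hr : (k : ℝ) ^ α < 1) {e : List (Fin k) → ℝ}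
    (he : Regular e) {v : List (Fin k)} {t : ℝ} (hv : v ∈ blocksAt α e t) :
    progenyExtinctionTime α e v t = deathTime α e v - t := by
  have hlt := lt_deathTime_of_mem_blocksAt hk hr he (List.suffix_refl v) hv
  -- The half-line is closed: a block present at some time has children born strictly later, so none
  -- is present at the death time itself.
  have : {s : ℝ | 0 ≤ s ∧ progeny α e v t s = 0} = Ici (deathTime α e v - t) := by
    ext s
    simp only [mem_ofPred_eq, mem_Ici, progeny, rankedMasses_eq_zero_iff hk]
    constructor
    · rintro ⟨hs, hempty⟩
      by_contra hlt'
      obtain ⟨w, hw⟩ := exists_mem_blocksAt (α := α) (e := e) (v := v) (t := t + s) hk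
        (by linarith [hv.1]) (by linarith)
      exact (hempty ▸ (show w ∈ {w | v <:+ w ∧ w ∈ blocksAt α e (t + s)} from hw) : w ∈ ∅)
    · intro hs
      refine ⟨by linarith, eq_empty_of_forall_notMem fun w hw => ?_⟩
      have := lt_deathTime_of_mem_blocksAt hk hr he hw.1 hw.2
      linarith
  rw [progenyExtinctionTime, this, csInf_Ici]

lemma extinctionTime_eq_height (hk : 0 < k) (hr : (k : ℝ) ^ α < 1) {e : List (Fin k) → ℝ}
    (he : Regular e) : extinctionTime α e = height α e := by
  have : {t : ℝ | 0 ≤ t ∧ fragmentation α e t = 0} = Ici (height α e) := by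
    ext t
    simp only [mem_ofPred_eq, mem_Ici, fragmentation, rankedMasses_eq_zero_iff hk]
    rw [← deathTime_nil]
    constructor
    · rintro ⟨ht, hempty⟩
      by_contra hlt
      obtain ⟨w, -, hw⟩ := exists_mem_blocksAt (α := α) (e := e) (v := []) hk
        (by simpa [birthTime] using ht) (not_le.1 hlt)
      exact (hempty ▸ hw : w ∈ ∅)
    · intro ht
      refine ⟨(height_pos hk hr he).le.trans (deathTime_nil (α := α) e ▸ ht),
        eq_empty_of_forall_notMem fun w hw => ?_⟩
      have := lt_deathTime_of_mem_blocksAt hk hr he (List.nil_suffix) hw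
      linarith
  rw [extinctionTime, this, csInf_Ici]

/-- Realisations for which, moreover, the last block to be reduced to dust is unique. -/
structure Generic (α : ℝ) (e : List (Fin k) → ℝ) : Prop extends Regular e where
  ne : ∀ v (i j : Fin k), i ≠ j →
    height α (KAryFragmentation.shift e (i :: v)) ≠ height α (KAryFragmentation.shift e (j :: v))

lemma Generic.shift {e : List (Fin k) → ℝ} (he : Generic α e) (v : List (Fin k)) :
    Generic α (shift e v) :=
  ⟨he.toRegular.shift v, fun w i j hij => by
    rw [shift_shift, shift_shift]; exact he.ne (w ++ v) i j hij⟩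

lemma deathTime_cons (e : List (Fin k) → ℝ) (i : Fin k) (v : List (Fin k)) :
    deathTime α e (i :: v) = birthTime α e v + lifetime α e v +
      ((k : ℝ) ^ α) ^ (v.length + 1) * height α (shift e (i :: v)) := rfl

lemma Generic.deathTime_ne (hk : 0 < k) {e : List (Fin k) → ℝ} (he : Generic α e)
    (v : List (Fin k)) {i j : Fin k} (hij : i ≠ j) :
    deathTime α e (i :: v) ≠ deathTime α e (j :: v) := by
  have hk' : (0 : ℝ) < k := by exact_mod_cast hk
  rw [deathTime_cons, deathTime_cons]
  intro h
  exact he.ne v i j hij (mul_left_cancel₀ (by positivity) (add_left_cancel h))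

open Classical in
/-- The child of the root whose progeny is the last to be reduced to dust. -/
noncomputable def lastChild (α : ℝ) (hk : 0 < k) (e : List (Fin k) → ℝ) : Fin k :=
  if h : ∃ i : Fin k, ∀ j, height α (shift e [j]) ≤ height α (shift e [i]) then h.choose
  else ⟨0, hk⟩

lemma le_height_lastChild (hk : 0 < k) (e : List (Fin k) → ℝ) (j : Fin k) :
    height α (shift e [j]) ≤ height α (shift e [lastChild α hk e]) := by
  have : Nonempty (Fin k) := ⟨⟨0, hk⟩⟩
  have h : ∃ i : Fin k, ∀ j, height α (shift e [j]) ≤ height α (shift e [i]) :=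
    Finite.exists_max fun i => height α (shift e [i])
  rw [lastChild, dif_pos h]
  exact h.choose_spec j

/-- The ancestral line of the last block to be reduced to dust. -/
noncomputable def lastLine (α : ℝ) (hk : 0 < k) (e : List (Fin k) → ℝ) : ℕ → List (Fin k)
  | 0 => []
  | n + 1 => lastChild α hk (shift e (lastLine α hk e n)) :: lastLine α hk e n

/-! ### The line of the last fragment and the sequence `Z` -/

lemma length_lastLine (hk : 0 < k) (e : List (Fin k) → ℝ) (n : ℕ) :
    (lastLine α hk e n).length = n := by
  induction n with
  | zero => rfl
  | succ n ih => simp [lastLine, ih]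

/-- The definition extends the line at its far end; splitting it at the root instead is what yields
the recursion `Zseq_succ`. -/
lemma lastLine_succ' (hk : 0 < k) (e : List (Fin k) → ℝ) (n : ℕ) :
    lastLine α hk e (n + 1) =
      lastLine α hk (shift e [lastChild α hk e]) n ++ [lastChild α hk e] := by
  induction n with
  | zero => simp [lastLine]
  | succ n ih =>
    rw [lastLine, ih]
    conv_rhs => rw [lastLine]
    rw [shift_shift, List.cons_append]

lemma deathTime_lastLine (hk : 0 < k) (hr : (k : ℝ) ^ α < 1) {e : List (Fin k) → ℝ}
    (he : Regular e) (n : ℕ) : deathTime α e (lastLine α hk e n) = height α e := by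
  have hk' : (0 : ℝ) < k := by exact_mod_cast hk
  induction n with
  | zero => exact deathTime_nil e
  | succ n ih =>
    rw [← ih]
    set v := lastLine α hk e n with hv
    obtain ⟨i, hi⟩ := exists_deathTime_cons_eq hk hr he v
    refine le_antisymm (deathTime_append_le hk hr he [_] v) ?_
    rw [← hi, lastLine, ← hv, deathTime_cons, deathTime_cons]
    have h := le_height_lastChild (α := α) hk (shift e v) i
    rw [shift_shift, shift_shift] at h
    have h' : height α (shift e (i :: v)) ≤
      height α (shift e (lastChild α hk (shift e v) :: v)) := h
    gcongr

lemma strictMono_birthTime_lastLine (hk : 0 < k) {e : List (Fin k) → ℝ} (he : Regular e) :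
    StrictMono fun n => birthTime α e (lastLine α hk e n) :=
  strictMono_nat_of_lt_succ fun _ => birthTime_lt_cons hk he _ _

lemma birthTime_lastLine_lt (hk : 0 < k) (hr : (k : ℝ) ^ α < 1) {e : List (Fin k) → ℝ}
    (he : Regular e) (n : ℕ) : birthTime α e (lastLine α hk e n) < height α e := by
  rw [← deathTime_lastLine hk hr he n]
  exact birthTime_lt_deathTime hk hr he _

/-- What remains after the `n`-th birth is `r ^ n` times the height of a subtree, and regularity
bounds that height linearly in `n`. -/
lemma tendsto_birthTime_lastLine (hk : 0 < k) (hr : (k : ℝ) ^ α < 1) {e : List (Fin k) → ℝ}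
    (he : Regular e) :
    Tendsto (fun n => birthTime α e (lastLine α hk e n)) atTop (𝓝 (height α e)) := by
  have hk' : (0 : ℝ) < k := by exact_mod_cast hk
  obtain ⟨a, b, ha, hb, h⟩ := he.bdd
  set r := (k : ℝ) ^ α with hrdef
  have hr0 : 0 < r := by positivity
  set C := b * (r / (1 - r) ^ 2) with hC
  have hr1 : 0 < 1 - r := by linarith
  have hlow : ∀ n : ℕ, height α e - ((a * (1 - r)⁻¹ + C) * r ^ n +
      b * (1 - r)⁻¹ * (n * r ^ n)) ≤ birthTime α e (lastLine α hk e n) := by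
    intro n
    set v := lastLine α hk e n with hv
    have h1 := deathTime_lastLine hk hr he n
    rw [deathTime, length_lastLine, ← hv] at h1
    have h2 : height α (shift e v) ≤ (a + b * n) * (1 - r)⁻¹ + C := by
      refine ciSup_le fun w => birthTime_le hk hr (by positivity) hb (fun u => ?_) w
      refine (h _).trans ?_
      rw [List.length_append, hv, length_lastLine, Nat.cast_add]
      linarith
    have h3 := mul_le_mul_of_nonneg_left h2 (pow_nonneg hr0.le n)
    have h4 : r ^ n * ((a + b * n) * (1 - r)⁻¹ + C) =
      (a * (1 - r)⁻¹ + C) * r ^ n + b * (1 - r)⁻¹ * (n * r ^ n) := by ring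
    rw [h4] at h3
    linarith
  refine tendsto_of_tendsto_of_tendsto_of_le_of_le ?_ tendsto_const_nhds hlow
    fun n => (birthTime_lastLine_lt hk hr he n).le
  have t1 := tendsto_pow_atTop_nhds_zero_of_lt_one hr0.le hr
  have t2 := tendsto_self_mul_const_pow_of_lt_one hr0.le hr
  have := (tendsto_const_nhds (x := height α e)).sub
    ((t1.const_mul (a * (1 - r)⁻¹ + C)).add (t2.const_mul (b * (1 - r)⁻¹)))
  simpa using this

lemma exists_lastLine_mem_blocksAt (hk : 0 < k) (hr : (k : ℝ) ^ α < 1) {e : List (Fin k) → ℝ}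
    (he : Regular e) {t : ℝ} (ht0 : 0 ≤ t) (ht : t < height α e) :
    ∃ n, lastLine α hk e n ∈ blocksAt α e t := by
  have hex : ∃ n, t < birthTime α e (lastLine α hk e n) :=
    ((tendsto_birthTime_lastLine hk hr he).eventually (lt_mem_nhds ht)).exists
  classical
  have hspec := Nat.find_spec hex
  obtain ⟨n, hn⟩ : ∃ n, Nat.find hex = n + 1 := by
    refine Nat.exists_eq_succ_of_ne_zero fun h => ?_
    rw [h] at hspec
    simp only [lastLine, birthTime] at hspec
    linarith
  rw [hn] at hspec
  exact ⟨n, not_lt.1 (Nat.find_min hex (m := n) (by omega)), hspec⟩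

lemma not_mem_blocksAt_append (hk : 0 < k) {e : List (Fin k) → ℝ} (he : Regular e)
    {t : ℝ} {v w : List (Fin k)} (hw : w ≠ []) (hv : v ∈ blocksAt α e t) :
    w ++ v ∉ blocksAt α e t := by
  rcases List.eq_nil_or_concat w with rfl | ⟨w', j, rfl⟩
  · exact absurd rfl hw
  intro h
  have h1 := birthTime_le_append (α := α) hk he w' (j :: v)
  rw [List.concat_eq_append, List.append_assoc] at h
  have h2 := h.1
  have h3 := hv.2
  have h4 : birthTime α e (j :: v) = birthTime α e v + lifetime α e v := rfl
  simp only [List.cons_append, List.nil_append] at h2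
  linarith

/-- A block off the line descends from a sibling of some block of the line. That sibling dies no
later than the line, and not at the same time since ties are excluded. -/
lemma deathTime_lt_of_not_suffix (hk : 0 < k) (hr : (k : ℝ) ^ α < 1) {e : List (Fin k) → ℝ}
    (he : Generic α e) {w : List (Fin k)} (n : ℕ) (h1 : ¬ lastLine α hk e n <:+ w)
    (h2 : ¬ w <:+ lastLine α hk e n) : deathTime α e w < height α e := by
  induction n with
  | zero => exact absurd List.nil_suffix h1
  | succ n ih =>
    by_cases h : lastLine α hk e n <:+ w
    · obtain ⟨u, rfl⟩ := h
      rcases List.eq_nil_or_concat u with rfl | ⟨u', j, rfl⟩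
      · exact absurd (List.suffix_cons _ _) h2
      rw [List.concat_eq_append, List.append_assoc] at h1 ⊢
      refine (deathTime_append_le hk hr he.toRegular u' _).trans_lt ?_
      have hj : j ≠ lastChild α hk (shift e (lastLine α hk e n)) := by
        rintro rfl
        exact h1 (List.suffix_append _ _)
      refine lt_of_le_of_ne ?_ ?_
      · rw [← deathTime_lastLine hk hr he.toRegular n]
        exact deathTime_append_le hk hr he.toRegular [j] _
      · rw [← deathTime_lastLine hk hr he.toRegular (n + 1)]
        exact he.deathTime_ne hk _ hj
    · exact ih h fun h' => h2 (h'.trans (List.suffix_cons _ _))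

/-- Two distinct blocks present at the same time are never ancestor and descendant. Any competitor
thus lies off the line and dies strictly earlier. -/
lemma isLastAt_iff (hk : 0 < k) (hr : (k : ℝ) ^ α < 1) {e : List (Fin k) → ℝ}
    (he : Generic α e) {t : ℝ} {n : ℕ} (hn : lastLine α hk e n ∈ blocksAt α e t)
    (v : List (Fin k)) : IsLastAt α e t v ↔ v = lastLine α hk e n := by
  have hmax : ∀ w ∈ blocksAt α e t, progenyExtinctionTime α e w t ≤ height α e - t := by
    intro w hw
    rw [progenyExtinctionTime_eq hk hr he.toRegular hw]
    have := deathTime_append_le hk hr he.toRegular w []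
    rw [List.append_nil, deathTime_nil] at this
    linarith
  have hline : progenyExtinctionTime α e (lastLine α hk e n) t = height α e - t := by
    rw [progenyExtinctionTime_eq hk hr he.toRegular hn, deathTime_lastLine hk hr he.toRegular]
  constructor
  · rintro ⟨hv, hlast⟩
    by_contra hne
    have h := hlast _ hn
    rw [hline, progenyExtinctionTime_eq hk hr he.toRegular hv] at h
    refine absurd (deathTime_lt_of_not_suffix hk hr he (w := v) n ?_ ?_) (by linarith)
    · rintro ⟨u, rfl⟩
      exact not_mem_blocksAt_append hk he.toRegular (by rintro rfl; exact hne rfl) hn hv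
    · rintro ⟨u, hu⟩
      rw [← hu] at hn
      exact not_mem_blocksAt_append hk he.toRegular (by rintro rfl; exact hne hu) hv hn
  · rintro rfl
    exact ⟨hn, fun w hw => hline ▸ hmax w hw⟩

lemma lastFragment_eq (hk : 0 < k) (hr : (k : ℝ) ^ α < 1) {e : List (Fin k) → ℝ}
    (he : Generic α e) {t : ℝ} (ht : 0 ≤ t) {n : ℕ}
    (hn : lastLine α hk e n ∈ blocksAt α e t) : lastFragment α e t = ((k : ℝ)⁻¹) ^ n := by
  have huniq : ∀ s : ℝ, 0 ≤ s ∧ s < extinctionTime α e → ∃! v, IsLastAt α e s v := by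
    rintro s ⟨hs0, hs⟩
    rw [extinctionTime_eq_height hk hr he.toRegular] at hs
    obtain ⟨m, hm⟩ := exists_lastLine_mem_blocksAt hk hr he.toRegular hs0 hs
    exact ⟨_, (isLastAt_iff hk hr he hm _).2 rfl, fun v hv => (isLastAt_iff hk hr he hm v).1 hv⟩
  have htlt : t < extinctionTime α e := by
    rw [extinctionTime_eq_height hk hr he.toRegular, ← deathTime_nil]
    exact lt_deathTime_of_mem_blocksAt hk hr he.toRegular List.nil_suffix hn
  have h : (∀ s : ℝ, 0 ≤ s ∧ s < extinctionTime α e → ∃! v, IsLastAt α e s v) ∧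
      (0 ≤ t ∧ t < extinctionTime α e) := ⟨huniq, ht, htlt⟩
  rw [lastFragment, dif_pos h]
  have hc := (h.1 t h.2).choose_spec.1
  rw [(isLastAt_iff hk hr he hn _).1 hc, mass, length_lastLine]

lemma lastLine_mem_blocksAt (hk : 0 < k) {e : List (Fin k) → ℝ} (he : Regular e) (n : ℕ) :
    lastLine α hk e n ∈ blocksAt α e (birthTime α e (lastLine α hk e n)) :=
  ⟨le_rfl, by linarith [lifetime_pos (α := α) hk he (lastLine α hk e n)]⟩

/-- Between the births of the `n`-th and `(n + 1)`-st blocks of the line `F_*` equals `k⁻¹ ^ n`, and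
from the latter birth on it is strictly smaller, including the value `0` after extinction. The
infimum is thus over a closed half-line. -/
lemma jumpTime_eq (hk : 2 ≤ k) (hr : (k : ℝ) ^ α < 1) {e : List (Fin k) → ℝ}
    (he : Generic α e) (n : ℕ) :
    jumpTime α e n = birthTime α e (lastLine α (by omega) e n) := by
  have hk0 : 0 < k := by omega
  have hk1 : (1 : ℝ) < k := by exact_mod_cast hk
  have hinv : (k : ℝ)⁻¹ < 1 := inv_lt_one_of_one_lt₀ hk1
  have hpos : (0 : ℝ) < (k : ℝ)⁻¹ := by positivity
  induction n with
  | zero => rfl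
  | succ n ih =>
    have hval := lastFragment_eq hk0 hr he (birthTime_nonneg hk0 he.toRegular _)
      (lastLine_mem_blocksAt (α := α) hk0 he.toRegular n)
    have hset : {t : ℝ | jumpTime α e n ≤ t ∧
        lastFragment α e t < lastFragment α e (jumpTime α e n)} =
        Ici (birthTime α e (lastLine α hk0 e (n + 1))) := by
      ext t
      rw [mem_ofPred_eq, ih, hval, mem_Ici]
      constructor
      · rintro ⟨h1, h2⟩
        by_contra h3
        rw [lastFragment_eq hk0 hr he ((birthTime_nonneg hk0 he.toRegular _).trans h1)
          (n := n) ⟨h1, not_le.1 h3⟩] at h2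
        exact lt_irrefl _ h2
      · intro h
        refine ⟨(strictMono_birthTime_lastLine hk0 he.toRegular (Nat.lt_succ_self n)).le.trans h,
          ?_⟩
        have ht0 := (birthTime_nonneg (α := α) hk0 he.toRegular _).trans h
        by_cases ht : t < height α e
        · obtain ⟨m, hm⟩ := exists_lastLine_mem_blocksAt hk0 hr he.toRegular ht0 ht
          rw [lastFragment_eq hk0 hr he ht0 hm]
          refine pow_lt_pow_right_of_lt_one₀ hpos hinv ?_
          have hlt : birthTime α e (lastLine α hk0 e (n + 1)) <
            birthTime α e (lastLine α hk0 e (m + 1)) := h.trans_lt hm.2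
          have := (strictMono_birthTime_lastLine hk0 he.toRegular).lt_iff_lt.1 hlt
          omega
        · have hzero : lastFragment α e t = 0 := by
            rw [lastFragment, dif_neg]
            rintro ⟨-, -, h'⟩
            rw [extinctionTime_eq_height hk0 hr he.toRegular] at h'
            exact ht h'
          rw [hzero]; positivity
    rw [jumpTime, hset, csInf_Ici]

/-- The factor `F_* ^ α`, equal to `(r ^ n)⁻¹`, undoes the time scale of generation `n`. -/
lemma Zseq_eq (hk : 2 ≤ k) (hr : (k : ℝ) ^ α < 1) {e : List (Fin k) → ℝ}
    (he : Generic α e) (n : ℕ) :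
    Zseq α e n = height α (shift e (lastLine α (by omega) e n)) := by
  have hk0 : 0 < k := by omega
  have hk' : (0 : ℝ) < k := by exact_mod_cast hk0
  rw [Zseq, jumpTime_eq hk hr he, extinctionTime_eq_height hk0 hr he.toRegular,
    lastFragment_eq hk0 hr he (birthTime_nonneg hk0 he.toRegular _)
      (lastLine_mem_blocksAt (α := α) hk0 he.toRegular n),
    ← deathTime_lastLine hk0 hr he.toRegular n, deathTime, length_lastLine, add_sub_cancel_left,
    ← mul_assoc, inv_pow, Real.inv_rpow (by positivity), ← Real.rpow_natCast,
    ← Real.rpow_mul hk'.le, mul_comm (n : ℝ), Real.rpow_mul hk'.le, Real.rpow_natCast,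
    inv_mul_cancel₀ (by positivity), one_mul]

lemma Zseq_zero (hk : 2 ≤ k) (hr : (k : ℝ) ^ α < 1) {e : List (Fin k) → ℝ}
    (he : Generic α e) : Zseq α e 0 = height α e := by
  rw [Zseq_eq hk hr he]; simp [lastLine]

lemma Zseq_succ (hk : 2 ≤ k) (hr : (k : ℝ) ^ α < 1) {e : List (Fin k) → ℝ}
    (he : Generic α e) (n : ℕ) :
    Zseq α e (n + 1) = Zseq α (shift e [lastChild α (by omega) e]) n := by
  rw [Zseq_eq hk hr he, Zseq_eq hk hr (he.shift _), lastLine_succ', shift_shift]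

lemma Generic.lt_height_lastChild (hk : 0 < k) {e : List (Fin k) → ℝ} (he : Generic α e)
    {j : Fin k} (hj : j ≠ lastChild α hk e) :
    height α (KAryFragmentation.shift e [j]) <
      height α (KAryFragmentation.shift e [lastChild α hk e]) :=
  lt_of_le_of_ne (le_height_lastChild hk e j) (he.ne [] _ _ hj)

/-- The recursive equation satisfied by the extinction time. -/
lemma height_eq (hk : 0 < k) (hr : (k : ℝ) ^ α < 1) {e : List (Fin k) → ℝ} (he : Regular e) :
    height α e = e [] + (k : ℝ) ^ α * height α (shift e [lastChild α hk e]) := by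
  have h := deathTime_lastLine hk hr he 1
  simp only [lastLine, shift_nil, deathTime_cons, birthTime, lifetime_eq hk] at h
  simpa using h.symm

end

end KAryFragmentation

namespace KAryFragmentation

open Set ENNReal

/-! ### The law of the family of lifetimes -/

instance : IsProbabilityMeasure (expMeasure 1) := isProbabilityMeasure_expMeasure one_pos

lemma lintegral_expMeasure {g : ℝ → ℝ≥0∞} (hg : Measurable g) :
    ∫⁻ t, g t ∂(expMeasure 1) = ∫⁻ t in Ioi 0, ENNReal.ofReal (Real.exp (-t)) * g t := by
  rw [expMeasure, gammaMeasure, lintegral_withDensity_eq_lintegral_mul _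
    (show Measurable (gammaPDF 1 1) from (measurable_gammaPDFReal 1 1).ennreal_ofReal) hg,
    ← lintegral_indicator measurableSet_Ioi]
  refine lintegral_congr_ae ?_
  have h0 : ∀ᵐ t : ℝ, t ≠ 0 := by simp [ae_iff]
  filter_upwards [h0] with t ht
  rcases lt_or_gt_of_ne ht with h | h
  · rw [Pi.mul_apply, gammaPDF_of_neg h, indicator_of_notMem (by simpa using h.le), zero_mul]
  · rw [Pi.mul_apply, gammaPDF_of_nonneg h.le, indicator_of_mem (by simpa using h)]
    simp

lemma lintegral_exp_mul_expMeasure_lt_top {a : ℝ} (ha : a < 1) :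
    ∫⁻ t, ENNReal.ofReal (Real.exp (a * t)) ∂(expMeasure 1) < ∞ := by
  rw [lintegral_expMeasure (by fun_prop)]
  have h := (exp_neg_integrableOn_Ioi 0 (sub_pos.2 ha)).lintegral_lt_top
  refine lt_of_le_of_lt (lintegral_mono fun t => ?_) h
  rw [← ENNReal.ofReal_mul (Real.exp_nonneg _), ← Real.exp_add]
  apply le_of_eq; congr 2; ring

lemma ae_expMeasure_pos : ∀ᵐ t ∂(expMeasure 1), 0 < t := by
  have h := lintegral_expMeasure (g := (Iic (0 : ℝ)).indicator 1)
    (measurable_const.indicator measurableSet_Iic)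
  rw [lintegral_indicator_one measurableSet_Iic] at h
  rw [ae_iff]
  simp only [not_lt]
  change expMeasure 1 (Iic 0) = 0
  rw [h]
  refine (setLIntegral_congr_fun measurableSet_Ioi (g := 0) fun t ht => ?_).trans (by simp)
  have : t ∉ Iic (0 : ℝ) := by simpa using ht
  simp [indicator_of_notMem this]

section

variable {k : ℕ}

/-- The law of the family of independent standard exponential normalised lifetimes. -/
noncomputable def lifetimeLaw (k : ℕ) : Measure (List (Fin k) → ℝ) :=
  Measure.infinitePi fun _ => expMeasure 1

instance : IsProbabilityMeasure (lifetimeLaw k) := by unfold lifetimeLaw; infer_instance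

lemma measurable_shift (v : List (Fin k)) : Measurable fun e : List (Fin k) → ℝ => shift e v :=
  measurable_pi_lambda _ fun w => measurable_pi_apply (w ++ v)

lemma map_shift_lifetimeLaw (v : List (Fin k)) :
    (lifetimeLaw k).map (fun e => shift e v) = lifetimeLaw k :=
  Measure.map_infinitePi_infinitePi_of_inj (P := fun _ : List (Fin k) => expMeasure 1)
    (f := fun w => w ++ v) (List.append_left_injective v)

lemma measurePreserving_shift (v : List (Fin k)) :
    MeasurePreserving (fun e => shift e v) (lifetimeLaw k) (lifetimeLaw k) :=
  ⟨measurable_shift v, map_shift_lifetimeLaw v⟩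

lemma measurePreserving_eval (v : List (Fin k)) :
    MeasurePreserving (fun e => e v) (lifetimeLaw k) (expMeasure 1) :=
  measurePreserving_eval_infinitePi (fun _ => expMeasure 1) v

/-- The word `v ++ [i]` determines `i` and `v`, so the progenies of the children use disjoint
coordinates of an i.i.d. family. -/
lemma map_shift_singleton_lifetimeLaw :
    (lifetimeLaw k).map (fun e (i : Fin k) => shift e [i]) =
      Measure.pi fun _ => lifetimeLaw k := by
  have hinj : Function.Injective fun p : Fin k × List (Fin k) => p.2 ++ [p.1] := by
    rintro ⟨i, v⟩ ⟨j, w⟩ h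
    have := List.append_inj' h rfl
    simp_all
  have h1 := Measure.map_infinitePi_infinitePi_of_inj
    (P := fun _ : List (Fin k) => expMeasure 1) hinj
  have h2 := Measure.infinitePi_map_curry (fun (_ : Fin k) (_ : List (Fin k)) => expMeasure 1)
  rw [← h1, Measure.map_map (by fun_prop) (by fun_prop)] at h2
  rw [← Measure.infinitePi_eq_pi]
  exact h2

/-- The coordinates `w ++ [i]` seen by the children never include the root coordinate `[]`. -/
lemma indepFun_eval_nil_shift :
    IndepFun (fun e : List (Fin k) → ℝ => e []) (fun e (i : Fin k) => shift e [i])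
      (lifetimeLaw k) := by
  have hind : iIndepFun (fun (v : List (Fin k)) (e : List (Fin k) → ℝ) => e v)
      (lifetimeLaw k) := iIndepFun_infinitePi (X := fun _ x => x) (by fun_prop)
  have h := indep_iSup_of_disjoint (S := {[]}) (T := {[]}ᶜ)
    (fun v => (measurable_pi_apply v).comap_le) hind disjoint_compl_right
  rw [IndepFun_iff_Indep]
  refine indep_of_indep_of_le_left (indep_of_indep_of_le_right h ?_) ?_
  · simp only [MeasurableSpace.pi, MeasurableSpace.comap_iSup, MeasurableSpace.comap_comp]
    exact iSup_le fun i => iSup_le fun w => le_iSup₂_of_le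
      (f := fun (v : List (Fin k)) (_ : v ∈ ({[]}ᶜ : Set (List (Fin k)))) =>
        MeasurableSpace.comap (fun e : List (Fin k) → ℝ => e v) inferInstance)
      (w ++ [i]) (by simp) le_rfl
  · exact le_iSup₂_of_le (f := fun (v : List (Fin k)) (_ : v ∈ ({[]} : Set (List (Fin k)))) =>
      MeasurableSpace.comap (fun e : List (Fin k) → ℝ => e v) inferInstance) [] rfl le_rfl

/-- The lifetime of the initial block and the progenies of its `k` children are independent. -/
lemma measurePreserving_split :
    MeasurePreserving (fun e : List (Fin k) → ℝ => (e [], fun i : Fin k => shift e [i]))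
      (lifetimeLaw k) ((expMeasure 1).prod (Measure.pi fun _ => lifetimeLaw k)) := by
  have hm : Measurable fun (e : List (Fin k) → ℝ) (i : Fin k) => shift e [i] :=
    measurable_pi_lambda _ fun i => measurable_shift [i]
  refine ⟨(measurable_pi_apply _).prodMk hm, ?_⟩
  rw [(indepFun_iff_map_prod_eq_prod_map_map (measurable_pi_apply _).aemeasurable
    hm.aemeasurable).1 indepFun_eval_nil_shift, map_shift_singleton_lifetimeLaw,
    (measurePreserving_eval []).map_eq]

/-! ### Measurability and exponential moments of the height -/

variable {α : ℝ}

lemma measurable_birthTime (v : List (Fin k)) :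
    Measurable fun e : List (Fin k) → ℝ => birthTime α e v := by
  induction v with
  | nil => exact measurable_const
  | cons i v ih => exact ih.add ((measurable_pi_apply v).const_mul _)

lemma measurable_height : Measurable fun e : List (Fin k) → ℝ => height α e :=
  Measurable.iSup fun v => measurable_birthTime v

lemma tsum_list_length (g : ℕ → ℝ≥0∞) :
    ∑' v : List (Fin k), g v.length = ∑' n : ℕ, (k : ℝ≥0∞) ^ n * g n := by
  rw [← (List.equivSigmaTuple (α := Fin k)).symm.tsum_eq, ENNReal.tsum_sigma']
  refine tsum_congr fun n => ?_
  have : ∀ f : Fin n → Fin k, ((List.equivSigmaTuple (α := Fin k)).symm ⟨n, f⟩).length = n :=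
    fun f => by simp [List.equivSigmaTuple]
  simp_rw [this, tsum_fintype]
  simp

/-- A random variable with finite mean which controls all lifetimes. -/
noncomputable def lifetimeBound (e : List (Fin k) → ℝ) : ℝ≥0∞ :=
  ∑' v : List (Fin k), ENNReal.ofReal (Real.exp (1 / 2 * e v)) *
    ENNReal.ofReal (Real.exp (-(2 * Real.log k * v.length)))

lemma measurable_lifetimeBound : Measurable (lifetimeBound (k := k)) := by
  unfold lifetimeBound
  exact Measurable.tsum fun v => by fun_prop

lemma lintegral_lifetimeBound_lt_top (hk : 2 ≤ k) :
    ∫⁻ e, lifetimeBound e ∂(lifetimeLaw k) < ∞ := by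
  have hk0 : (0 : ℝ) < k := by positivity
  have hk1 : (1 : ℝ) < k := by exact_mod_cast hk
  unfold lifetimeBound
  rw [lintegral_tsum fun v => Measurable.aemeasurable (by fun_prop)]
  have h1 : ∀ v : List (Fin k), ∫⁻ e, ENNReal.ofReal (Real.exp (1 / 2 * e v)) *
      ENNReal.ofReal (Real.exp (-(2 * Real.log k * v.length))) ∂(lifetimeLaw k) =
      (∫⁻ t, ENNReal.ofReal (Real.exp (1 / 2 * t)) ∂(expMeasure 1)) *
        ENNReal.ofReal (Real.exp (-(2 * Real.log k * v.length))) := by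
    intro v
    rw [lintegral_mul_const _ (by fun_prop)]
    congr 1
    exact (measurePreserving_eval v).lintegral_comp
      (f := fun t => ENNReal.ofReal (Real.exp (1 / 2 * t))) (by fun_prop)
  simp_rw [h1]
  rw [ENNReal.tsum_mul_left,
    tsum_list_length fun n => ENNReal.ofReal (Real.exp (-(2 * Real.log k * n)))]
  refine ENNReal.mul_lt_top (lintegral_exp_mul_expMeasure_lt_top (by norm_num)) ?_
  -- The `k ^ n` words of length `n` meet the weight `k ^ (-2 n)`, leaving a geometric series of
  -- ratio `k⁻¹`.
  have h2 : ∀ n : ℕ, (k : ℝ≥0∞) ^ n * ENNReal.ofReal (Real.exp (-(2 * Real.log k * n))) =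
      ENNReal.ofReal (((k : ℝ)⁻¹) ^ n) := by
    intro n
    rw [← ENNReal.ofReal_natCast, ← ENNReal.ofReal_pow hk0.le,
      ← ENNReal.ofReal_mul (by positivity)]
    congr 1
    have : Real.exp (-(2 * Real.log k * n)) = ((k : ℝ)⁻¹ ^ n) * ((k : ℝ)⁻¹ ^ n) := by
      have h3 : ((k : ℝ)⁻¹ ^ n) = Real.exp (-(n * Real.log k)) := by
        rw [Real.exp_neg, Real.exp_nat_mul, Real.exp_log hk0, inv_pow]
      rw [h3, ← Real.exp_add]; congr 1; ring
    rw [this, ← mul_assoc, ← mul_pow, mul_inv_cancel₀ hk0.ne', one_pow, one_mul]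
  simp_rw [h2]
  exact (summable_geometric_of_lt_one (by positivity)
    (inv_lt_one_of_one_lt₀ hk1)).tsum_ofReal_lt_top

lemma le_of_lifetimeBound_ne_top {e : List (Fin k) → ℝ} (h : lifetimeBound e ≠ ∞)
    (v : List (Fin k)) :
    e v ≤ 2 * Real.log (lifetimeBound e).toReal + 4 * Real.log k * v.length := by
  have h1 : ENNReal.ofReal (Real.exp (1 / 2 * e v - 2 * Real.log k * v.length)) ≤
      lifetimeBound e := by
    refine le_trans (le_of_eq ?_) (ENNReal.le_tsum v)
    rw [← ENNReal.ofReal_mul (Real.exp_nonneg _), ← Real.exp_add]; rfl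
  rw [ENNReal.ofReal_le_iff_le_toReal h] at h1
  have h2 := Real.log_le_log (Real.exp_pos _) h1
  rw [Real.log_exp] at h2
  linarith

lemma ae_lifetime_pos : ∀ᵐ e ∂(lifetimeLaw k), ∀ v, 0 < e v :=
  ae_all_iff.2 fun v => (measurePreserving_eval v).quasiMeasurePreserving.ae ae_expMeasure_pos

lemma ae_lifetimeBound_ne_top (hk : 2 ≤ k) : ∀ᵐ e ∂(lifetimeLaw k), lifetimeBound e ≠ ∞ := by
  filter_upwards [ae_lt_top measurable_lifetimeBound (lintegral_lifetimeBound_lt_top hk).ne]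
    with e he using he.ne

lemma log_lifetimeBound_nonneg {e : List (Fin k) → ℝ} (hpos : 0 < e [])
    (h : lifetimeBound e ≠ ∞) : 0 ≤ Real.log (lifetimeBound e).toReal := by
  have := le_of_lifetimeBound_ne_top h []
  simp at this
  linarith

lemma ae_regular (hk : 2 ≤ k) : ∀ᵐ e ∂(lifetimeLaw k), Regular e := by
  have hk1 : (1 : ℝ) ≤ k := by exact_mod_cast (by omega : 1 ≤ k)
  filter_upwards [ae_lifetime_pos, ae_lifetimeBound_ne_top hk] with e he he'
  exact ⟨he, _, _, mul_nonneg two_pos.le (log_lifetimeBound_nonneg (he _) he'),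
    mul_nonneg four_pos.le (Real.log_nonneg hk1), le_of_lifetimeBound_ne_top he'⟩

/-- The extinction time has some exponential moment. -/
lemma exists_lintegral_exp_height_lt_top (hk : 2 ≤ k) (hr : (k : ℝ) ^ α < 1) :
    ∃ a : ℝ, 0 < a ∧
      ∫⁻ e, ENNReal.ofReal (Real.exp (a * height α e)) ∂(lifetimeLaw k) < ∞ := by
  have hk1 : (1 : ℝ) ≤ k := by exact_mod_cast (by omega : 1 ≤ k)
  have hk0 : 0 < k := by omega
  set r := (k : ℝ) ^ α with hrdef
  -- The height is at most `2 * log S / (1 - r) + B`, where `S` is `lifetimeBound`; this `a` gives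
  -- `log S` the coefficient `1`, so the exponential is bounded by a multiple of the integrable `S`.
  set a := (1 - r) / 2 with ha
  have ha0 : 0 < a := by rw [ha]; linarith
  set B := 4 * Real.log k * (r / (1 - r) ^ 2) with hB
  refine ⟨a, ha0, ?_⟩
  have hle : ∀ᵐ e ∂(lifetimeLaw k), ENNReal.ofReal (Real.exp (a * height α e)) ≤
      ENNReal.ofReal (Real.exp (a * B)) * lifetimeBound e := by
    filter_upwards [ae_lifetime_pos, ae_lifetimeBound_ne_top hk] with e he he'
    have hlog := log_lifetimeBound_nonneg (he []) he'
    have h1 : height α e ≤ 2 * Real.log (lifetimeBound e).toReal * (1 - r)⁻¹ + B :=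
      ciSup_le fun w => birthTime_le hk0 hr (by positivity)
        (mul_nonneg four_pos.le (Real.log_nonneg hk1)) (le_of_lifetimeBound_ne_top he') w
    have hpos : 0 < (lifetimeBound e).toReal := by
      refine ENNReal.toReal_pos (fun h => ?_) he'
      have := ENNReal.tsum_eq_zero.1 h []
      simp only [mul_eq_zero, ENNReal.ofReal_eq_zero, not_le.2 (Real.exp_pos _), or_self] at this
    have h2 : Real.exp (a * height α e) ≤ Real.exp (a * B) * (lifetimeBound e).toReal := by
      rw [← Real.exp_log hpos, ← Real.exp_add]
      refine Real.exp_le_exp.2 ?_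
      have h3 := mul_le_mul_of_nonneg_left h1 ha0.le
      have h4 : a * (2 * Real.log (lifetimeBound e).toReal * (1 - r)⁻¹ + B) =
          a * B + Real.log (lifetimeBound e).toReal := by
        have : 1 - r ≠ 0 := by linarith
        rw [ha]; field_simp; ring
      linarith
    calc ENNReal.ofReal (Real.exp (a * height α e))
        ≤ ENNReal.ofReal (Real.exp (a * B) * (lifetimeBound e).toReal) :=
          ENNReal.ofReal_le_ofReal h2
      _ = _ := by rw [ENNReal.ofReal_mul (Real.exp_nonneg _), ENNReal.ofReal_toReal he']
  refine lt_of_le_of_lt (lintegral_mono_ae hle) ?_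
  rw [lintegral_const_mul _ measurable_lifetimeBound]
  exact ENNReal.mul_lt_top ENNReal.ofReal_lt_top (lintegral_lifetimeBound_lt_top hk)

lemma ae_height_eq (hk : 2 ≤ k) (hr : (k : ℝ) ^ α < 1) : ∀ᵐ e ∂(lifetimeLaw k),
    (∀ i, e [] + (k : ℝ) ^ α * height α (shift e [i]) ≤ height α e) ∧
      ∃ i, height α e = e [] + (k : ℝ) ^ α * height α (shift e [i]) := by
  have hk0 : 0 < k := by omega
  have hk' : (0 : ℝ) < k := by exact_mod_cast hk0
  filter_upwards [ae_regular hk] with e he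
  refine ⟨fun i => ?_, _, height_eq hk0 hr he⟩
  rw [height_eq hk0 hr he]
  have := le_height_lastChild (α := α) hk0 e i
  gcongr

/-- The extinction time has an exponential moment of order `k ^ α`. -/
lemma lintegral_exp_height_lt_top (hk : 2 ≤ k) (hr : (k : ℝ) ^ α < 1) :
    ∫⁻ e, ENNReal.ofReal (Real.exp ((k : ℝ) ^ α * height α e)) ∂(lifetimeLaw k) < ∞ := by
  have hk' : (0 : ℝ) < k := by positivity
  set r := (k : ℝ) ^ α with hrdef
  have hr0 : 0 < r := by positivity
  set Φ : ℝ → ℝ≥0∞ :=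
    fun a => ∫⁻ e, ENNReal.ofReal (Real.exp (a * height α e)) ∂(lifetimeLaw k) with hΦ
  have hmeas : ∀ a, Measurable fun e : List (Fin k) → ℝ =>
      ENNReal.ofReal (Real.exp (a * height α e)) := fun a =>
    (Real.measurable_exp.comp (measurable_height.const_mul a)).ennreal_ofReal
  -- The recursion for the height bounds `exp (a * ζ)` by the sum over children of `exp (a * T) *
  -- exp (a * r * ζ_i)`. The factors are independent, and `a < 1` makes the first integrable.
  have hstep : ∀ a, 0 ≤ a → a < 1 → Φ (a * r) < ∞ → Φ a < ∞ := by
    intro a ha0 ha1 hfin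
    have hle : Φ a ≤ ∫⁻ e, ∑ i : Fin k, ENNReal.ofReal (Real.exp (a * e [])) *
        ENNReal.ofReal (Real.exp (a * r * height α (shift e [i]))) ∂(lifetimeLaw k) := by
      refine lintegral_mono_ae ?_
      filter_upwards [ae_height_eq hk hr] with e he
      obtain ⟨i, hi⟩ := he.2
      refine le_trans (le_of_eq ?_) (Finset.single_le_sum (fun _ _ => zero_le) (Finset.mem_univ i))
      rw [← ENNReal.ofReal_mul (Real.exp_nonneg _), ← Real.exp_add, hi]
      congr 2; ring
    refine hle.trans_lt ?_
    rw [lintegral_finsetSum _ fun i _ => ?_]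
    · refine ENNReal.sum_lt_top.2 fun i _ => ?_
      have h1 := indepFun_eval_nil_shift (k := k)
      have h2 := h1.comp (φ := fun t => ENNReal.ofReal (Real.exp (a * t)))
        (ψ := fun f => ENNReal.ofReal (Real.exp (a * r * height α (f i)))) (by fun_prop)
        ((hmeas (a * r)).comp (measurable_pi_apply i))
      have h3 := lintegral_mul_eq_lintegral_mul_lintegral_of_indepFun
        (f := fun e : List (Fin k) → ℝ => ENNReal.ofReal (Real.exp (a * e [])))
        (g := fun e => ENNReal.ofReal (Real.exp (a * r * height α (shift e [i]))))
        (by fun_prop) ((hmeas (a * r)).comp (measurable_shift [i])) h2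
      simp only [Pi.mul_apply] at h3
      rw [h3]
      refine ENNReal.mul_lt_top ?_ ?_
      · rw [(measurePreserving_eval []).lintegral_comp
          (f := fun t => ENNReal.ofReal (Real.exp (a * t))) (by fun_prop)]
        exact lintegral_exp_mul_expMeasure_lt_top ha1
      · rw [(measurePreserving_shift [i]).lintegral_comp
          (f := fun e => ENNReal.ofReal (Real.exp (a * r * height α e))) (hmeas _)]
        exact hfin
    · exact Measurable.mul (by fun_prop) ((hmeas (a * r)).comp (measurable_shift [i]))
  obtain ⟨a, ha0, ha⟩ := exists_lintegral_exp_height_lt_top (α := α) hk hr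
  -- Start from an exponent `r ^ (n + 1)` below the known `a` and climb to `r` by repeated division
  -- by `r`; all intermediate exponents stay below `1`.
  obtain ⟨n, hn⟩ := exists_pow_lt_of_lt_one ha0 hr
  have hn' : Φ (r ^ (n + 1)) < ∞ := by
    refine lt_of_le_of_lt (lintegral_mono_ae ?_) ha
    filter_upwards [ae_regular hk] with e he
    refine ENNReal.ofReal_le_ofReal (Real.exp_le_exp.2 ?_)
    have h0 := (height_pos (α := α) (by omega) hr he).le
    have : r ^ (n + 1) ≤ a := (pow_le_pow_of_le_one hr0.le hr.le (Nat.le_succ n)).trans hn.le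
    gcongr
  have hdown : ∀ m : ℕ, Φ (r ^ (m + 1)) < ∞ → Φ r < ∞ := by
    intro m
    induction m with
    | zero => intro h; simpa using h
    | succ m ih =>
      intro h
      refine ih (hstep _ (by positivity) (pow_lt_one₀ hr0.le hr (by omega)) ?_)
      rwa [← pow_succ]
  exact hdown n hn'

end

end KAryFragmentation

namespace KAryFragmentation

open Set ENNReal

/-! ### The law of the extinction time -/

section

variable {k : ℕ} {α : ℝ}

/-- The law of the extinction time. -/
noncomputable def heightLaw (k : ℕ) (α : ℝ) : Measure ℝ := (lifetimeLaw k).map (height α)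

instance : IsProbabilityMeasure (heightLaw k α) :=
  Measure.isProbabilityMeasure_map measurable_height.aemeasurable

lemma heightLaw_Iic_zero (hk : 2 ≤ k) (hr : (k : ℝ) ^ α < 1) : heightLaw k α (Iic 0) = 0 := by
  rw [heightLaw, Measure.map_apply measurable_height measurableSet_Iic]
  change lifetimeLaw k {e | height α e ≤ 0} = 0
  have h : ∀ᵐ e ∂(lifetimeLaw k), ¬ height α e ≤ 0 := by
    filter_upwards [ae_regular hk] with e he
    exact not_le.2 (height_pos (by omega) hr he)
  simpa only [not_not] using ae_iff.1 h

/-- The height is at most `x` exactly when `T + r * ζ_i ≤ x` for every child, and given `T` these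
are `k` independent events. -/
lemma heightLaw_Iic (hk : 2 ≤ k) (hr : (k : ℝ) ^ α < 1) (x : ℝ) :
    heightLaw k α (Iic x) =
      ∫⁻ t, heightLaw k α (Iic ((x - t) / (k : ℝ) ^ α)) ^ k ∂(expMeasure 1) := by
  have hk' : (0 : ℝ) < k := by positivity
  set r := (k : ℝ) ^ α with hrdef
  have hr0 : 0 < r := by positivity
  set T : Set (ℝ × (Fin k → List (Fin k) → ℝ)) := {p | ∀ i, p.1 + r * height α (p.2 i) ≤ x}
    with hT
  have hTm : MeasurableSet T := by
    have : T = ⋂ i, {p | p.1 + r * height α (p.2 i) ≤ x} := by ext; simp [hT]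
    rw [this]
    refine MeasurableSet.iInter fun i => measurableSet_le ?_ measurable_const
    exact measurable_fst.add ((measurable_height.comp
      ((measurable_pi_apply i).comp measurable_snd)).const_mul r)
  have h1 : heightLaw k α (Iic x) =
      lifetimeLaw k ((fun e : List (Fin k) → ℝ => (e [], fun i : Fin k => shift e [i])) ⁻¹' T) := by
    rw [heightLaw, Measure.map_apply measurable_height measurableSet_Iic]
    refine measure_congr ?_
    filter_upwards [ae_height_eq hk hr] with e he
    apply propext
    change height α e ≤ x ↔ ∀ i, e [] + r * height α (shift e [i]) ≤ x
    constructor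
    · exact fun h i => (he.1 i).trans h
    · intro h
      obtain ⟨i, hi⟩ := he.2
      exact hi ▸ h i
  rw [h1, measurePreserving_split.measure_preimage hTm.nullMeasurableSet,
    Measure.prod_apply hTm]
  refine lintegral_congr fun t => ?_
  have h2 : Prod.mk t ⁻¹' T =
      Set.univ.pi fun _ : Fin k => {e | height α e ≤ (x - t) / r} := by
    ext f
    simp only [hT, mem_preimage, mem_ofPred_eq, mem_univ_pi]
    refine forall_congr' fun i => ?_
    rw [le_div_iff₀ hr0]
    constructor <;> intro h <;> linarith
  rw [h2, Measure.pi_pi, Finset.prod_const, Finset.card_univ, Fintype.card_fin, heightLaw,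
    Measure.map_apply measurable_height measurableSet_Iic]
  rfl

lemma cdf_heightLaw_of_nonpos (hk : 2 ≤ k) (hr : (k : ℝ) ^ α < 1) {x : ℝ} (hx : x ≤ 0) :
    cdf (heightLaw k α) x = 0 := by
  have h : heightLaw k α (Iic x) = 0 :=
    measure_mono_null (Iic_subset_Iic.2 hx) (heightLaw_Iic_zero hk hr)
  rw [cdf_eq_real, measureReal_def, h, toReal_zero]

lemma integrableOn_exp_mul_cdf (x : ℝ) :
    IntegrableOn (fun u => Real.exp u * cdf (heightLaw k α) (u / (k : ℝ) ^ α) ^ k) (Iic x) := by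
  refine Integrable.mono' (integrableOn_exp_Iic x) ?_ ?_
  · have : Measurable fun u => cdf (heightLaw k α) u := (monotone_cdf _).measurable
    exact (Real.measurable_exp.mul
      ((this.comp (measurable_id.div_const _)).pow_const k)).aestronglyMeasurable
  · refine Eventually.of_forall fun u => ?_
    have h0 := cdf_nonneg (heightLaw k α) (u / (k : ℝ) ^ α)
    rw [Real.norm_of_nonneg (by positivity)]
    exact mul_le_of_le_one_right (Real.exp_nonneg _) (pow_le_one₀ h0 (cdf_le_one _ _))

/-- Substitute `u = x - t` in the integral against the exponential law. The integral starts at `0`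
because `F` vanishes on `(-∞, 0]`. -/
lemma exp_mul_cdf_heightLaw (hk : 2 ≤ k) (hr : (k : ℝ) ^ α < 1) (x : ℝ) :
    Real.exp x * cdf (heightLaw k α) x =
      ∫ u in (0 : ℝ)..x, Real.exp u * cdf (heightLaw k α) (u / (k : ℝ) ^ α) ^ k := by
  set r := (k : ℝ) ^ α with hrdef
  set F := cdf (heightLaw k α) with hF
  have key : ∀ y, Real.exp y * F y = ∫ u in Iic y, Real.exp u * F (u / r) ^ k := by
    intro y
    have h1 : heightLaw k α (Iic y) = ∫⁻ u in Iio y,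
        ENNReal.ofReal (Real.exp (u - y)) * heightLaw k α (Iic (u / r)) ^ k := by
      have hm : Measurable fun u => heightLaw k α (Iic (u / r)) := by
        have : Monotone fun u => heightLaw k α (Iic u) :=
          fun u v huv => measure_mono (Iic_subset_Iic.2 huv)
        exact this.measurable.comp (measurable_id.div_const r)
      have hm' : Measurable fun t => heightLaw k α (Iic ((y - t) / r)) ^ k :=
        (hm.comp (measurable_const.sub measurable_id)).pow_const k
      rw [heightLaw_Iic hk hr, lintegral_expMeasure hm',
        ← lintegral_indicator measurableSet_Ioi, ← lintegral_indicator measurableSet_Iio,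
        ← lintegral_sub_left_eq_self _ y]
      refine lintegral_congr fun t => ?_
      by_cases ht : t < y
      · rw [indicator_of_mem (show y - t ∈ Ioi 0 from sub_pos.2 ht),
          indicator_of_mem (show t ∈ Iio y from ht), neg_sub, sub_sub_self]
      · rw [indicator_of_notMem (show y - t ∉ Ioi 0 by simpa using ht),
          indicator_of_notMem (show t ∉ Iio y from ht)]
    have h2 : F y = ∫ u in Iio y, Real.exp (u - y) * F (u / r) ^ k := by
      rw [integral_eq_lintegral_of_nonneg_ae]
      · rw [cdf_eq_real, measureReal_def, h1]
        congr 1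
        refine lintegral_congr fun u => ?_
        rw [ENNReal.ofReal_mul (Real.exp_nonneg _), ENNReal.ofReal_pow (cdf_nonneg _ _),
          ofReal_cdf]
      · exact Eventually.of_forall fun u =>
          mul_nonneg (Real.exp_nonneg _) (pow_nonneg (cdf_nonneg _ _) _)
      · have : Measurable fun u => F u := (monotone_cdf _).measurable
        exact ((Real.measurable_exp.comp (measurable_id.sub_const y)).mul
          ((this.comp (measurable_id.div_const _)).pow_const k)).aestronglyMeasurable
    rw [h2, integral_Iic_eq_integral_Iio, ← integral_const_mul]
    refine integral_congr_ae (Eventually.of_forall fun u => ?_)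
    simp only
    rw [← mul_assoc, ← Real.exp_add, add_sub_cancel]
  have h0 := key 0
  rw [show F 0 = 0 from cdf_heightLaw_of_nonpos hk hr le_rfl, mul_zero] at h0
  have h1 : ∫ u in Iic x, Real.exp u * F (u / r) ^ k = (∫ u in Iic x, Real.exp u * F (u / r) ^ k) -
      ∫ u in Iic (0 : ℝ), Real.exp u * F (u / r) ^ k := by rw [← h0, sub_zero]
  rw [key x, h1]
  exact intervalIntegral.integral_Iic_sub_Iic (integrableOn_exp_mul_cdf 0)
    (integrableOn_exp_mul_cdf x)

lemma intervalIntegrable_exp_mul_cdf (a b : ℝ) : IntervalIntegrable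
    (fun u => Real.exp u * cdf (heightLaw k α) (u / (k : ℝ) ^ α) ^ k) volume a b :=
  ⟨(integrableOn_exp_mul_cdf b).mono_set Ioc_subset_Iic_self,
    (integrableOn_exp_mul_cdf a).mono_set Ioc_subset_Iic_self⟩

lemma cdf_heightLaw_eq (hk : 2 ≤ k) (hr : (k : ℝ) ^ α < 1) (x : ℝ) :
    cdf (heightLaw k α) x = Real.exp (-x) *
      ∫ u in (0 : ℝ)..x, Real.exp u * cdf (heightLaw k α) (u / (k : ℝ) ^ α) ^ k := by
  rw [← exp_mul_cdf_heightLaw hk hr, ← mul_assoc, ← Real.exp_add, neg_add_cancel, Real.exp_zero,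
    one_mul]

lemma continuous_cdf_heightLaw (hk : 2 ≤ k) (hr : (k : ℝ) ^ α < 1) :
    Continuous (cdf (heightLaw k α)) := by
  rw [funext (cdf_heightLaw_eq hk hr)]
  exact (Real.continuous_exp.comp continuous_neg).mul
    (intervalIntegral.continuous_primitive intervalIntegrable_exp_mul_cdf 0)

lemma nullSingletonClass_heightLaw (hk : 2 ≤ k) (hr : (k : ℝ) ^ α < 1) :
    NullSingletonClass (heightLaw k α) := by
  refine ⟨fun x => ?_⟩
  have h := (cdf (heightLaw k α)).measure_singleton x
  rw [measure_cdf] at h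
  rw [h, leftLim_eq_of_tendsto
    (((continuous_cdf_heightLaw hk hr).tendsto x).mono_left nhdsWithin_le_nhds)]
  simp

/-- The density of the extinction time. -/
noncomputable def heightDensity (k : ℕ) (α x : ℝ) : ℝ :=
  cdf (heightLaw k α) (x / (k : ℝ) ^ α) ^ k - cdf (heightLaw k α) x

lemma hasDerivAt_exp_mul_cdf (hk : 2 ≤ k) (hr : (k : ℝ) ^ α < 1) (x : ℝ) :
    HasDerivAt (fun x => Real.exp x * cdf (heightLaw k α) x)
      (Real.exp x * cdf (heightLaw k α) (x / (k : ℝ) ^ α) ^ k) x := by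
  rw [funext (exp_mul_cdf_heightLaw hk hr)]
  have hc : Continuous fun u => Real.exp u * cdf (heightLaw k α) (u / (k : ℝ) ^ α) ^ k :=
    Real.continuous_exp.mul
      (((continuous_cdf_heightLaw hk hr).comp (continuous_id.div_const _)).pow k)
  exact (hc.integral_hasStrictDerivAt 0 x).hasDerivAt

lemma hasDerivAt_cdf_heightLaw (hk : 2 ≤ k) (hr : (k : ℝ) ^ α < 1) (x : ℝ) :
    HasDerivAt (cdf (heightLaw k α)) (heightDensity k α x) x := by
  have h1 := (Real.hasDerivAt_exp (-x)).comp x (hasDerivAt_neg x)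
  have h2 := h1.mul (hasDerivAt_exp_mul_cdf hk hr x)
  have e1 : ((Real.exp ∘ Neg.neg) * fun x => Real.exp x * cdf (heightLaw k α) x) =
      cdf (heightLaw k α) := by
    funext y
    simp only [Pi.mul_apply, Function.comp]
    rw [← mul_assoc, ← Real.exp_add, neg_add_cancel, Real.exp_zero, one_mul]
  rw [e1] at h2
  refine h2.congr_deriv ?_
  have : Real.exp (-x) * Real.exp x = 1 := by rw [← Real.exp_add]; simp
  simp only [Function.comp, heightDensity]
  linear_combination (cdf (heightLaw k α) (x / (k : ℝ) ^ α) ^ k -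
    cdf (heightLaw k α) x) * this

lemma heightDensity_nonneg (hk : 2 ≤ k) (hr : (k : ℝ) ^ α < 1) (x : ℝ) :
    0 ≤ heightDensity k α x := by
  rw [← (hasDerivAt_cdf_heightLaw hk hr x).deriv]
  exact (monotone_cdf _).deriv_nonneg

lemma continuous_heightDensity (hk : 2 ≤ k) (hr : (k : ℝ) ^ α < 1) :
    Continuous (heightDensity k α) :=
  (((continuous_cdf_heightLaw hk hr).comp (continuous_id.div_const _)).pow k).sub
    (continuous_cdf_heightLaw hk hr)

lemma heightDensity_of_nonpos (hk : 2 ≤ k) (hr : (k : ℝ) ^ α < 1) {x : ℝ} (hx : x ≤ 0) :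
    heightDensity k α x = 0 := by
  have hk' : (0 : ℝ) < k := by positivity
  rw [heightDensity, cdf_heightLaw_of_nonpos hk hr hx, cdf_heightLaw_of_nonpos hk hr
    (div_nonpos_of_nonpos_of_nonneg hx (by positivity)), zero_pow (by omega), sub_zero]

lemma heightLaw_eq_withDensity (hk : 2 ≤ k) (hr : (k : ℝ) ^ α < 1) :
    heightLaw k α = volume.withDensity fun x => ENNReal.ofReal (heightDensity k α x) := by
  have h : ∀ x, (volume.withDensity fun x => ENNReal.ofReal (heightDensity k α x)) (Iic x) =
      heightLaw k α (Iic x) := by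
    intro x
    have hint : IntegrableOn (heightDensity k α) (Iic x) := by
      have h0 : IntegrableOn (heightDensity k α) (Iic 0) :=
        (integrableOn_zero (ε' := ℝ)).congr_fun
          (fun y hy => (heightDensity_of_nonpos hk hr hy).symm) measurableSet_Iic
      refine (h0.union
        ((continuous_heightDensity hk hr).integrableOn_Ioc (a := 0) (b := x))).mono_set fun y hy => ?_
      rcases le_or_gt y 0 with h | h
      · exact Or.inl h
      · exact Or.inr ⟨h, hy⟩
    rw [withDensity_apply _ measurableSet_Iic, ← ofReal_integral_eq_lintegral_ofReal hint
      (Eventually.of_forall fun y => heightDensity_nonneg hk hr y),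
      integral_Iic_of_hasDerivAt_of_tendsto' (fun y _ => hasDerivAt_cdf_heightLaw hk hr y) hint
        (tendsto_cdf_atBot _), sub_zero, ofReal_cdf]
  refine Measure.ext_of_Iic _ _ fun x => (h x).symm

/-- If `F y = 0` with `y > 0`, then `F` vanishes on the left of `y`, so `f y = 0` by continuity,
which forces `F (y / r) = 0`. Iteration makes `F` vanish along a sequence tending to infinity. -/
lemma cdf_heightLaw_pos (hk : 2 ≤ k) (hr : (k : ℝ) ^ α < 1) {x : ℝ} (hx : 0 < x) :
    0 < cdf (heightLaw k α) x := by
  have hk' : (0 : ℝ) < k := by positivity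
  set r := (k : ℝ) ^ α with hrdef
  have hr0 : 0 < r := by positivity
  by_contra hcon
  have hstep : ∀ y, 0 < y → cdf (heightLaw k α) y = 0 → cdf (heightLaw k α) (y / r) = 0 := by
    intro y hy h0
    have hz : ∀ᶠ z in 𝓝[<] y, heightDensity k α z = 0 := by
      filter_upwards [self_mem_nhdsWithin] with z hz
      have hev : cdf (heightLaw k α) =ᶠ[𝓝 z] fun _ => 0 := by
        filter_upwards [gt_mem_nhds (show z < y from hz)] with w hw
        exact le_antisymm (h0 ▸ monotone_cdf _ hw.le) (cdf_nonneg _ _)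
      rw [← (hasDerivAt_cdf_heightLaw hk hr z).deriv, hev.deriv_eq, deriv_const]
    have hlim := ((continuous_heightDensity hk hr).tendsto y).mono_left
      (nhdsWithin_le_nhds (s := Iio y))
    have h1 : heightDensity k α y = 0 :=
      tendsto_nhds_unique (hlim.congr' hz) tendsto_const_nhds
    rw [heightDensity, h0, sub_zero] at h1
    exact eq_zero_of_pow_eq_zero h1
  have hall : ∀ n : ℕ, cdf (heightLaw k α) (x * (r⁻¹) ^ n) = 0 := by
    intro n
    induction n with
    | zero => simpa using le_antisymm (not_lt.1 hcon) (cdf_nonneg _ _)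
    | succ n ih =>
      have := hstep _ (by positivity) ih
      rwa [div_eq_mul_inv, mul_assoc, ← pow_succ] at this
  have hlim : Tendsto (fun n : ℕ => x * (r⁻¹) ^ n) atTop atTop :=
    (tendsto_pow_atTop_atTop_of_one_lt ((one_lt_inv₀ hr0).2 hr)).const_mul_atTop hx
  have h1 := (tendsto_cdf_atTop (heightLaw k α)).comp hlim
  have h2 : Tendsto (fun n : ℕ => cdf (heightLaw k α) (x * (r⁻¹) ^ n)) atTop (𝓝 0) := by
    simp_rw [hall]; exact tendsto_const_nhds
  exact one_ne_zero (tendsto_nhds_unique h1 h2)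

/-- Ties between the progenies of siblings have probability zero. -/
lemma ae_generic (hk : 2 ≤ k) (hr : (k : ℝ) ^ α < 1) :
    ∀ᵐ e ∂(lifetimeLaw k), Generic α e := by
  have := nullSingletonClass_heightLaw hk hr
  have hties : ∀ i j : Fin k, i ≠ j →
      ∀ᵐ e ∂(lifetimeLaw k), height α (shift e [i]) ≠ height α (shift e [j]) := by
    intro i j hij
    -- The heights of two siblings are independent with an atomless law, so the diagonal is null.
    have h1 : (lifetimeLaw k).map (fun e => (height α (shift e [i]), height α (shift e [j]))) =
        (heightLaw k α).prod (heightLaw k α) := by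
      have h2 := Measure.infinitePi_map_eval_prod (P := fun _ : Fin k => lifetimeLaw k) hij
      rw [Measure.infinitePi_eq_pi, ← map_shift_singleton_lifetimeLaw,
        Measure.map_map (by fun_prop)
          (measurable_pi_lambda _ fun i => measurable_shift [i])] at h2
      have h3 := Measure.map_prod_map (lifetimeLaw k) (lifetimeLaw k)
        (measurable_height (α := α)) (measurable_height (α := α))
      have h4 := Measure.map_map (μ := lifetimeLaw k)
        ((measurable_height (α := α)).prodMap (measurable_height (α := α)))
        ((measurable_shift [i]).prodMk (measurable_shift [j]))
      rw [heightLaw, h3, ← h2]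
      exact h4.symm
    have hm : Measurable fun e : List (Fin k) → ℝ =>
        (height α (shift e [i]), height α (shift e [j])) :=
      (measurable_height.comp (measurable_shift [i])).prodMk
        (measurable_height.comp (measurable_shift [j]))
    have hdiag : MeasurableSet {p : ℝ × ℝ | p.1 = p.2} :=
      measurableSet_eq_fun measurable_fst measurable_snd
    rw [ae_iff]
    simp only [ne_eq, not_not]
    have h4 : (lifetimeLaw k) {e | height α (shift e [i]) = height α (shift e [j])} =
        ((heightLaw k α).prod (heightLaw k α)) {p : ℝ × ℝ | p.1 = p.2} := by
      rw [← h1, Measure.map_apply hm hdiag]; rfl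
    rw [h4, Measure.prod_apply hdiag]
    have h5 : ∀ x : ℝ, Prod.mk x ⁻¹' {p : ℝ × ℝ | p.1 = p.2} = {x} := by
      intro x; ext y; simp [eq_comm]
    simp [h5]
  have hall : ∀ᵐ e ∂(lifetimeLaw k), ∀ (v : List (Fin k)) (i j : Fin k), i ≠ j →
      height α (shift e (i :: v)) ≠ height α (shift e (j :: v)) := by
    refine ae_all_iff.2 fun v => ae_all_iff.2 fun i => ae_all_iff.2 fun j => ?_
    by_cases hij : i = j
    · exact Eventually.of_forall fun e h => absurd hij h
    · filter_upwards [(measurePreserving_shift v).quasiMeasurePreserving.ae (hties i j hij)]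
        with e he _
      rw [shift_shift, shift_shift] at he
      exact he
  filter_upwards [ae_regular hk, hall] with e he he'
  exact ⟨he, he'⟩

end

end KAryFragmentation

namespace KAryFragmentation

open Set ENNReal

/-! ### The transition kernel as a truncated kernel -/

section

variable {k : ℕ} {α : ℝ}

/-- The weight of the transition density with respect to the law of the extinction time. -/
noncomputable def weight (k : ℕ) (α y : ℝ) : ℝ :=
  k * Real.exp ((k : ℝ) ^ α * y) * cdf (heightLaw k α) y ^ (k - 1)

/-- The measure whose truncations are the transition laws of the chain. -/
noncomputable def transitionMeasure (k : ℕ) (α : ℝ) : Measure ℝ :=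
  (heightLaw k α).withDensity fun y => ENNReal.ofReal (weight k α y)

lemma weight_nonneg (y : ℝ) : 0 ≤ weight k α y := by
  have := cdf_nonneg (heightLaw k α) y
  unfold weight; positivity

lemma continuous_weight (hk : 2 ≤ k) (hr : (k : ℝ) ^ α < 1) : Continuous (weight k α) :=
  (continuous_const.mul (Real.continuous_exp.comp (continuous_const.mul continuous_id))).mul
    ((continuous_cdf_heightLaw hk hr).pow _)

lemma weight_pos (hk : 2 ≤ k) (hr : (k : ℝ) ^ α < 1) {y : ℝ} (hy : 0 < y) :
    0 < weight k α y := by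
  have := cdf_heightLaw_pos hk hr hy
  have hk' : (0 : ℝ) < k := by positivity
  unfold weight; positivity

/-- The weight is at most `k * exp (r * y)`, so this is exactly the exponential moment of order `r`
of the extinction time. -/
lemma isFiniteMeasure_transitionMeasure (hk : 2 ≤ k) (hr : (k : ℝ) ^ α < 1) :
    IsFiniteMeasure (transitionMeasure k α) := by
  refine isFiniteMeasure_withDensity (ne_of_lt ?_)
  have h1 : ∀ y, ENNReal.ofReal (weight k α y) ≤
      k * ENNReal.ofReal (Real.exp ((k : ℝ) ^ α * y)) := by
    intro y
    rw [← ENNReal.ofReal_natCast, ← ENNReal.ofReal_mul (by positivity)]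
    exact ENNReal.ofReal_le_ofReal (mul_le_of_le_one_right (by positivity)
      (pow_le_one₀ (cdf_nonneg _ _) (cdf_le_one _ _)))
  refine lt_of_le_of_lt (lintegral_mono h1) ?_
  rw [lintegral_const_mul _ (by fun_prop), heightLaw,
    lintegral_map (by fun_prop) measurable_height]
  exact ENNReal.mul_lt_top (by simp) (lintegral_exp_height_lt_top hk hr)

lemma transitionMeasure_Iic_zero (hk : 2 ≤ k) (hr : (k : ℝ) ^ α < 1) :
    transitionMeasure k α (Iic 0) = 0 :=
  withDensity_absolutelyContinuous _ _ (heightLaw_Iic_zero hk hr)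

lemma transitionMeasure_apply (hk : 2 ≤ k) (hr : (k : ℝ) ^ α < 1) {B : Set ℝ}
    (hB : MeasurableSet B) : transitionMeasure k α B =
      ∫⁻ y in B, ENNReal.ofReal (weight k α y * heightDensity k α y) := by
  rw [transitionMeasure, withDensity_apply _ hB, heightLaw_eq_withDensity hk hr,
    setLIntegral_withDensity_eq_setLIntegral_mul _
      (continuous_heightDensity hk hr).measurable.ennreal_ofReal
      (continuous_weight hk hr).measurable.ennreal_ofReal hB]
  refine lintegral_congr fun y => ?_
  rw [Pi.mul_apply, mul_comm, ENNReal.ofReal_mul (weight_nonneg y)]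

/-- The function `V s = exp (r * s) * (F s ^ k - F (r * s))` is a primitive of the density of `ν`:
the two terms `r * exp (r * s) * F s ^ k` in its derivative cancel. It vanishes for `s ≤ 0`;
evaluate it at `s = x / r`. -/
lemma transitionMeasure_Iio (hk : 2 ≤ k) (hr : (k : ℝ) ^ α < 1) (x : ℝ) :
    transitionMeasure k α (Iio (((k : ℝ) ^ α)⁻¹ * x)) =
      ENNReal.ofReal (Real.exp x * heightDensity k α x) := by
  have hk' : (0 : ℝ) < k := by positivity
  set r := (k : ℝ) ^ α with hrdef
  have hr0 : 0 < r := by positivity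
  set V : ℝ → ℝ := fun s => Real.exp (r * s) * heightDensity k α (r * s) with hV
  set g : ℝ → ℝ := fun s => weight k α s * heightDensity k α s with hg
  have hVd : ∀ s, HasDerivAt V (g s) s := by
    intro s
    have h1 : HasDerivAt (fun s => r * s) r s := by simpa using (hasDerivAt_id s).const_mul r
    have h2 : HasDerivAt (fun s => Real.exp (r * s)) (Real.exp (r * s) * r) s :=
      (Real.hasDerivAt_exp _).comp s h1
    have h3 := (hasDerivAt_cdf_heightLaw hk hr s).pow k
    have h4 : HasDerivAt (fun s => Real.exp (r * s) * cdf (heightLaw k α) (r * s)) _ s :=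
      (hasDerivAt_exp_mul_cdf hk hr (r * s)).comp s h1
    have h5 := (h2.mul h3).sub h4
    have e1 : V = ((fun s => Real.exp (r * s)) * cdf (heightLaw k α) ^ k) -
        fun s => Real.exp (r * s) * cdf (heightLaw k α) (r * s) := by
      funext s
      simp only [hV, heightDensity, Pi.sub_apply, Pi.mul_apply, Pi.pow_apply]
      rw [← hrdef, mul_div_cancel_left₀ _ hr0.ne']
      ring
    rw [e1]
    refine h5.congr_deriv ?_
    simp only [hg, weight, Pi.pow_apply]
    rw [← hrdef, mul_div_cancel_left₀ _ hr0.ne']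
    ring
  have hgc : Continuous g := (continuous_weight hk hr).mul (continuous_heightDensity hk hr)
  have hint : ∀ s, IntegrableOn g (Iic s) := by
    intro s
    have h0 : IntegrableOn g (Iic 0) :=
      (integrableOn_zero (ε' := ℝ)).congr_fun
        (fun y hy => by simp [hg, heightDensity_of_nonpos hk hr hy]) measurableSet_Iic
    refine (h0.union (hgc.integrableOn_Ioc (a := 0) (b := s))).mono_set fun y hy => ?_
    rcases le_or_gt y 0 with h | h
    · exact Or.inl h
    · exact Or.inr ⟨h, hy⟩
  have hbot : Tendsto V atBot (𝓝 0) := by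
    refine tendsto_const_nhds.congr' ?_
    filter_upwards [eventually_le_atBot 0] with s hs
    simp [hV, heightDensity_of_nonpos hk hr (mul_nonpos_of_nonneg_of_nonpos hr0.le hs)]
  rw [transitionMeasure_apply hk hr measurableSet_Iio, setLIntegral_congr Iio_ae_eq_Iic,
    ← ofReal_integral_eq_lintegral_ofReal (hint _) (Eventually.of_forall fun y =>
      mul_nonneg (weight_nonneg y) (heightDensity_nonneg hk hr y)),
    integral_Iic_of_hasDerivAt_of_tendsto' (fun y _ => hVd y) (hint _) hbot, sub_zero]
  simp only [hV]
  rw [mul_inv_cancel_left₀ hr0.ne']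

lemma transitionMeasure_Iio_ne_zero (hk : 2 ≤ k) (hr : (k : ℝ) ^ α < 1) {s : ℝ} (hs : 0 < s) :
    transitionMeasure k α (Iio s) ≠ 0 := by
  intro h
  rw [transitionMeasure, withDensity_apply_eq_zero
    (continuous_weight hk hr).measurable.ennreal_ofReal] at h
  have h1 : heightLaw k α (Iic (s / 2)) = 0 := by
    refine measure_mono_null (t := Iic 0 ∪ ({x | ENNReal.ofReal (weight k α x) ≠ 0} ∩ Iio s))
      (fun y hy => ?_) (measure_union_null (heightLaw_Iic_zero hk hr) h)
    rcases le_or_gt y 0 with hy0 | hy0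
    · exact Or.inl hy0
    · refine Or.inr ⟨?_, lt_of_le_of_lt (mem_Iic.1 hy) (half_lt_self hs)⟩
      simpa using weight_pos hk hr hy0
  rw [← ofReal_cdf, ENNReal.ofReal_eq_zero] at h1
  exact absurd h1 (not_le.2 (cdf_heightLaw_pos hk hr (by linarith)))

/-- Read off from `transitionMeasure_Iio`: `exp x * f x` is the mass of a set that `ν` charges.
Division by `f x` in the kernel is thereby legitimate. -/
lemma heightDensity_pos (hk : 2 ≤ k) (hr : (k : ℝ) ^ α < 1) {x : ℝ} (hx : 0 < x) :
    0 < heightDensity k α x := by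
  have hk' : (0 : ℝ) < k := by positivity
  have h := transitionMeasure_Iio_ne_zero hk hr
    (show 0 < ((k : ℝ) ^ α)⁻¹ * x by positivity)
  rw [transitionMeasure_Iio hk hr, Ne, ENNReal.ofReal_eq_zero, not_le] at h
  exact pos_of_mul_pos_right h (Real.exp_nonneg x)

/-- The prefactor `exp (-x) / f x` is the inverse of the mass `exp x * f x` of the truncation set.
For `x ≤ 0` both sides are zero. -/
lemma lintegral_transitionDensity (hk : 2 ≤ k) (hr : (k : ℝ) ^ α < 1) (x : ℝ) {B : Set ℝ}
    (hB : MeasurableSet B) :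
    ∫⁻ y in B, ENNReal.ofReal (transitionDensity k α (cdf (heightLaw k α)) x y) =
      truncKernel (transitionMeasure k α) ((k : ℝ) ^ α)⁻¹ x B := by
  have hk' : (0 : ℝ) < k := by positivity
  have hr0 : 0 < (k : ℝ) ^ α := by positivity
  rcases le_or_gt x 0 with hx | hx
  · rw [truncKernel_of_nonpos (transitionMeasure_Iic_zero hk hr) (by positivity) hx]
    have h : ∀ y, transitionDensity k α (cdf (heightLaw k α)) x y = 0 := by
      intro y
      rw [transitionDensity, if_neg]
      rintro ⟨h1, h2⟩
      have := mul_nonpos_of_nonneg_of_nonpos (Real.rpow_nonneg hk'.le (-α)) hx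
      linarith
    simp [h]
  have hm : Measurable fun y => ENNReal.ofReal (weight k α y * heightDensity k α y) :=
    ((continuous_weight hk hr).mul (continuous_heightDensity hk hr)).measurable.ennreal_ofReal
  rw [truncKernel_apply _ _ _ hB, transitionMeasure_Iio hk hr,
    transitionMeasure_apply hk hr (hB.inter measurableSet_Iio), ← lintegral_const_mul _ hm,
    ← lintegral_indicator hB, ← lintegral_indicator (hB.inter measurableSet_Iio)]
  refine lintegral_congr fun y => ?_
  have hf := heightDensity_pos hk hr hx
  by_cases hyB : y ∈ B
  · rw [indicator_of_mem hyB, transitionDensity, Real.rpow_neg hk'.le]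
    by_cases hy : y < ((k : ℝ) ^ α)⁻¹ * x
    · rw [indicator_of_mem (show y ∈ B ∩ Iio (((k : ℝ) ^ α)⁻¹ * x) from ⟨hyB, hy⟩)]
      rcases le_or_gt y 0 with hy0 | hy0
      · rw [if_neg fun h => absurd h.1 (not_lt.2 hy0), heightDensity_of_nonpos hk hr hy0]
        simp
      · rw [if_pos ⟨hy0, hy⟩, ← ENNReal.ofReal_inv_of_pos (by positivity),
          ← ENNReal.ofReal_mul (by positivity), (hasDerivAt_cdf_heightLaw hk hr x).deriv,
          (hasDerivAt_cdf_heightLaw hk hr y).deriv, weight, Real.exp_neg]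
        congr 1
        field_simp
    · rw [if_neg fun h => hy h.2, indicator_of_notMem fun h => hy h.2, ENNReal.ofReal_zero]
  · rw [indicator_of_notMem hyB, indicator_of_notMem fun h => hyB h.1]

lemma isStationaryLaw_iff (hk : 2 ≤ k) (hr : (k : ℝ) ^ α < 1) (π : Measure ℝ) :
    IsStationaryLaw k α (cdf (heightLaw k α)) π ↔ IsProbabilityMeasure π ∧ π (Iic 0) = 0 ∧
      π.bind (truncKernel (transitionMeasure k α) ((k : ℝ) ^ α)⁻¹) = π := by
  have hk' : (0 : ℝ) < k := by positivity
  have hm := measurable_truncKernel (transitionMeasure k α)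
    (show 0 < ((k : ℝ) ^ α)⁻¹ by positivity)
  constructor
  · rintro ⟨h1, h2, h3⟩
    refine ⟨h1, h2, Measure.ext fun B hB => ?_⟩
    rw [← h3 B hB, Measure.bind_apply hB hm.aemeasurable]
    exact lintegral_congr fun x => (lintegral_transitionDensity hk hr x hB).symm
  · rintro ⟨h1, h2, h3⟩
    refine ⟨h1, h2, fun B hB => ?_⟩
    conv_rhs => rw [← h3, Measure.bind_apply hB hm.aemeasurable]
    exact lintegral_congr fun x => lintegral_transitionDensity hk hr x hB

end

end KAryFragmentation

namespace KAryFragmentation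

open Set ENNReal

/-! ### The law of the chain -/

/-- Integration over the event that the `i`-th of `k` independent copies is the largest. -/
lemma lintegral_pi_isMax {X : Type*} [MeasurableSpace X] (P : Measure X) [IsProbabilityMeasure P]
    {k : ℕ} (i : Fin k) {h : X → ℝ} (hh : Measurable h) {g : X → ℝ≥0∞} (hg : Measurable g) :
    ∫⁻ f, {f : Fin k → X | ∀ j, j ≠ i → h (f j) < h (f i)}.indicator (fun f => g (f i)) f
        ∂(Measure.pi fun _ => P) = ∫⁻ x, g x * P {y | h y < h x} ^ (k - 1) ∂P := by
  obtain _ | n := k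
  · exact i.elim0
  have hm : MeasurableSet {f : Fin (n + 1) → X | ∀ j, j ≠ i → h (f j) < h (f i)} := by
    have : {f : Fin (n + 1) → X | ∀ j, j ≠ i → h (f j) < h (f i)} =
        ⋂ j, ⋂ (_ : j ≠ i), {f | h (f j) < h (f i)} := by ext; simp
    rw [this]
    exact MeasurableSet.iInter fun j => MeasurableSet.iInter fun _ =>
      measurableSet_lt (hh.comp (measurable_pi_apply j)) (hh.comp (measurable_pi_apply i))
  have hmeas : Measurable ({f : Fin (n + 1) → X | ∀ j, j ≠ i → h (f j) < h (f i)}.indicator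
      fun f => g (f i)) := (hg.comp (measurable_pi_apply i)).indicator hm
  have hmp := (measurePreserving_piFinSuccAbove (fun _ : Fin (n + 1) => P) i).symm
  have hcomp : Measurable fun p => {f : Fin (n + 1) → X | ∀ j, j ≠ i → h (f j) < h (f i)}.indicator
      (fun f => g (f i)) ((MeasurableEquiv.piFinSuccAbove (fun _ => X) i).symm p) :=
    hmeas.comp hmp.measurable
  -- Separate the `i`-th copy from the `k - 1` others; once it is fixed, the event is a product set
  -- in the others.
  rw [← hmp.lintegral_comp hmeas, lintegral_prod _ hcomp.aemeasurable]
  refine lintegral_congr fun x => ?_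
  have h1 : ∀ f : Fin n → X, {f : Fin (n + 1) → X | ∀ j, j ≠ i → h (f j) < h (f i)}.indicator
      (fun f => g (f i)) ((MeasurableEquiv.piFinSuccAbove (fun _ => X) i).symm (x, f)) =
      (Set.univ.pi fun _ : Fin n => {y | h y < h x}).indicator (fun _ => g x) f := by
    intro f
    have h2 : (MeasurableEquiv.piFinSuccAbove (fun _ => X) i).symm (x, f) ∈
        {f : Fin (n + 1) → X | ∀ j, j ≠ i → h (f j) < h (f i)} ↔
        f ∈ Set.univ.pi fun _ : Fin n => {y | h y < h x} := by
      simp only [MeasurableEquiv.piFinSuccAbove_symm_apply, mem_ofPred_eq, mem_univ_pi,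
        Fin.insertNthEquiv, Equiv.coe_fn_mk, Fin.insertNth_apply_same]
      constructor
      · intro H j
        simpa using H (i.succAbove j) (Fin.succAbove_ne i j)
      · intro H j hj
        obtain ⟨j', rfl⟩ := Fin.exists_succAbove_eq hj
        simpa using H j'
    by_cases hf : f ∈ Set.univ.pi fun _ : Fin n => {y | h y < h x}
    · rw [indicator_of_mem hf, indicator_of_mem (h2.2 hf)]
      simp [MeasurableEquiv.piFinSuccAbove_symm_apply, Fin.insertNthEquiv]
    · rw [indicator_of_notMem hf, indicator_of_notMem fun H => hf (h2.1 H)]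
  simp_rw [h1]
  rw [lintegral_indicator_const
    (MeasurableSet.univ_pi fun _ => measurableSet_lt hh measurable_const),
    Measure.pi_pi]
  simp

section

variable {k : ℕ} {α : ℝ}

/-- A measurable version of the chain. -/
noncomputable def chain (α : ℝ) : ℕ → (List (Fin k) → ℝ) → ℝ
  | 0 => height α
  | n + 1 => fun e => ∑ i : Fin k,
      {e : List (Fin k) → ℝ | ∀ j, j ≠ i →
        height α (shift e [j]) < height α (shift e [i])}.indicator
        (fun e => chain α n (shift e [i])) e

lemma measurableSet_isMax (α : ℝ) (i : Fin k) : MeasurableSet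
    {e : List (Fin k) → ℝ | ∀ j, j ≠ i → height α (shift e [j]) < height α (shift e [i])} := by
  have : {e : List (Fin k) → ℝ | ∀ j, j ≠ i → height α (shift e [j]) < height α (shift e [i])} =
      ⋂ j, ⋂ (_ : j ≠ i), {e | height α (shift e [j]) < height α (shift e [i])} := by ext; simp
  rw [this]
  exact MeasurableSet.iInter fun j => MeasurableSet.iInter fun _ =>
    measurableSet_lt (measurable_height.comp (measurable_shift [j]))
      (measurable_height.comp (measurable_shift [i]))

lemma measurable_chain (n : ℕ) : Measurable (chain α n : (List (Fin k) → ℝ) → ℝ) := by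
  induction n with
  | zero => exact measurable_height
  | succ n ih =>
    exact Finset.measurable_fun_sum _ fun i _ =>
      (ih.comp (measurable_shift [i])).indicator (measurableSet_isMax α i)

lemma Generic.mem_isMax_iff (hk : 0 < k) {e : List (Fin k) → ℝ} (he : Generic α e) (i : Fin k) :
    e ∈ {e : List (Fin k) → ℝ | ∀ j, j ≠ i → height α (KAryFragmentation.shift e [j]) <
      height α (KAryFragmentation.shift e [i])} ↔ i = lastChild α hk e := by
  constructor
  · intro h
    by_contra hne
    exact lt_asymm (h _ (Ne.symm hne)) (he.lt_height_lastChild hk hne)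
  · rintro rfl j hj
    exact he.lt_height_lastChild hk hj

lemma Generic.sum_isMax (hk : 0 < k) {e : List (Fin k) → ℝ} (he : Generic α e) {M : Type*}
    [AddCommMonoid M] (g : Fin k → (List (Fin k) → ℝ) → M) :
    ∑ i : Fin k, {e : List (Fin k) → ℝ | ∀ j, j ≠ i → height α (KAryFragmentation.shift e [j]) <
      height α (KAryFragmentation.shift e [i])}.indicator (g i) e = g (lastChild α hk e) e := by
  rw [Finset.sum_eq_single (lastChild α hk e)]
  · exact indicator_of_mem ((he.mem_isMax_iff hk _).2 rfl) _
  · intro i _ hi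
    exact indicator_of_notMem (fun h => hi ((he.mem_isMax_iff hk i).1 h)) _
  · simp

lemma Generic.chain_succ (hk : 0 < k) {e : List (Fin k) → ℝ} (he : Generic α e) (n : ℕ) :
    chain α (n + 1) e = chain α n (KAryFragmentation.shift e [lastChild α hk e]) :=
  he.sum_isMax hk fun i e => chain α n (KAryFragmentation.shift e [i])

lemma Generic.Zseq_eq_chain (hk : 2 ≤ k) (hr : (k : ℝ) ^ α < 1) {e : List (Fin k) → ℝ}
    (he : Generic α e) (n : ℕ) : Zseq α e n = chain α n e := by
  induction n generalizing e with
  | zero => exact Zseq_zero hk hr he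
  | succ n ih => rw [Zseq_succ hk hr he, he.chain_succ (by omega), ih (he.shift _)]

/-- The action of one step of the chain on densities with respect to the extinction time. -/
noncomputable def densityStep (k : ℕ) (α : ℝ) (g : ℝ → ℝ≥0∞) (y : ℝ) : ℝ≥0∞ :=
  k * heightLaw k α (Iio y) ^ (k - 1) * ∫⁻ t, g (t + (k : ℝ) ^ α * y) ∂(expMeasure 1)

lemma measurable_heightLaw_Iio : Measurable fun y => heightLaw k α (Iio y) := by
  have : Monotone fun y => heightLaw k α (Iio y) :=
    fun y z hyz => measure_mono (Iio_subset_Iio hyz)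
  exact this.measurable

lemma measurable_lintegral_add_mul {g : ℝ → ℝ≥0∞} (hg : Measurable g) (r : ℝ) :
    Measurable fun y => ∫⁻ t, g (t + r * y) ∂(expMeasure 1) := by
  have : Measurable fun p : ℝ × ℝ => g (p.2 + r * p.1) := by fun_prop
  exact this.lintegral_prod_right'

lemma measurable_densityStep {g : ℝ → ℝ≥0∞} (hg : Measurable g) :
    Measurable (densityStep k α g) :=
  ((measurable_heightLaw_Iio.pow_const _).const_mul _).mul (measurable_lintegral_add_mul hg _)

/-- Split according to the last child `i`: then `ζ = T + r * ζ_i`, and `Z_{n+1}` is the `n`-th term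
of the chain of that child. Integrating out `T` and the `k - 1` siblings of smaller height leaves an
integral over the progeny of `i` alone, and the `k` choices of `i` contribute equally. -/
lemma lintegral_height_mul_chain_succ (hk : 2 ≤ k) (hr : (k : ℝ) ^ α < 1) (n : ℕ)
    {g φ : ℝ → ℝ≥0∞} (hg : Measurable g) (hφ : Measurable φ) :
    ∫⁻ e : List (Fin k) → ℝ, g (height α e) * φ (chain α (n + 1) e) ∂(lifetimeLaw k) =
      ∫⁻ e, densityStep k α g (height α e) * φ (chain α n e) ∂(lifetimeLaw k) := by
  have hk0 : 0 < k := by omega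
  set r := (k : ℝ) ^ α with hrdef
  set A : Fin k → Set (Fin k → List (Fin k) → ℝ) :=
    fun i => {f | ∀ j, j ≠ i → height α (f j) < height α (f i)} with hA
  set G : Fin k → ℝ × (Fin k → List (Fin k) → ℝ) → ℝ≥0∞ := fun i p =>
    (A i).indicator (fun f => g (p.1 + r * height α (f i)) * φ (chain α n (f i))) p.2 with hG
  have hAm : ∀ i, MeasurableSet (A i) := by
    intro i
    have : A i = ⋂ j, ⋂ (_ : j ≠ i), {f | height α (f j) < height α (f i)} := by
      ext; simp [hA]
    rw [this]
    exact MeasurableSet.iInter fun j => MeasurableSet.iInter fun _ =>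
      measurableSet_lt (measurable_height.comp (measurable_pi_apply j))
        (measurable_height.comp (measurable_pi_apply i))
  have hGm : ∀ i, Measurable (G i) := by
    intro i
    have h1 : Measurable fun p : ℝ × (Fin k → List (Fin k) → ℝ) => p.2 i :=
      (measurable_pi_apply i).comp measurable_snd
    have h2 : Measurable fun p : ℝ × (Fin k → List (Fin k) → ℝ) =>
        g (p.1 + r * height α (p.2 i)) * φ (chain α n (p.2 i)) :=
      (hg.comp (measurable_fst.add ((measurable_height.comp h1).const_mul r))).mul
        (hφ.comp ((measurable_chain n).comp h1))
    exact h2.indicator (measurable_snd (hAm i))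
  have h1 : ∫⁻ e : List (Fin k) → ℝ, g (height α e) * φ (chain α (n + 1) e) ∂(lifetimeLaw k) =
      ∫⁻ e : List (Fin k) → ℝ, ∑ i, G i (e [], fun i => shift e [i]) ∂(lifetimeLaw k) := by
    refine lintegral_congr_ae ?_
    filter_upwards [ae_generic hk hr] with e he
    rw [he.chain_succ hk0, height_eq hk0 hr he.toRegular]
    exact (he.sum_isMax hk0 fun i e =>
      g (e [] + r * height α (shift e [i])) * φ (chain α n (shift e [i]))).symm
  have h2 : ∀ i, ∫⁻ e : List (Fin k) → ℝ, G i (e [], fun i => shift e [i]) ∂(lifetimeLaw k) =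
      ∫⁻ e, heightLaw k α (Iio (height α e)) ^ (k - 1) *
        (∫⁻ t, g (t + r * height α e) ∂(expMeasure 1)) * φ (chain α n e) ∂(lifetimeLaw k) := by
    intro i
    rw [measurePreserving_split.lintegral_comp (hGm i), lintegral_prod _ (hGm i).aemeasurable]
    have h3 : ∀ t, ∫⁻ f, G i (t, f) ∂(Measure.pi fun _ => lifetimeLaw k) =
        ∫⁻ e, g (t + r * height α e) * φ (chain α n e) *
          heightLaw k α (Iio (height α e)) ^ (k - 1) ∂(lifetimeLaw k) := by
      intro t
      have h4 : Measurable fun e : List (Fin k) → ℝ =>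
          g (t + r * height α e) * φ (chain α n e) :=
        (hg.comp ((measurable_height.const_mul r).const_add t)).mul (hφ.comp (measurable_chain n))
      refine (lintegral_pi_isMax (lifetimeLaw k) i measurable_height h4).trans ?_
      refine lintegral_congr fun e => ?_
      rw [heightLaw, Measure.map_apply measurable_height measurableSet_Iio]
      rfl
    simp_rw [h3]
    rw [lintegral_lintegral_swap]
    · refine lintegral_congr fun e => ?_
      have h5 : Measurable fun t => g (t + r * height α e) :=
        hg.comp (measurable_id.add_const _)
      rw [lintegral_mul_const _ (h5.mul_const _), lintegral_mul_const _ h5]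
      ring
    · have h6 : Measurable fun p : ℝ × (List (Fin k) → ℝ) => height α p.2 :=
        measurable_height.comp measurable_snd
      exact (((hg.comp (measurable_fst.add (h6.const_mul r))).mul
        (hφ.comp ((measurable_chain n).comp measurable_snd))).mul
        ((measurable_heightLaw_Iio.comp h6).pow_const _)).aemeasurable
  have hGs : ∀ i, Measurable fun e : List (Fin k) → ℝ => G i (e [], fun i => shift e [i]) :=
    fun i => (hGm i).comp measurePreserving_split.measurable
  rw [h1, lintegral_finsetSum _ fun i _ => hGs i]
  simp_rw [h2]
  rw [Finset.sum_const, Finset.card_univ, Fintype.card_fin, nsmul_eq_mul, ← lintegral_const_mul]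
  · refine lintegral_congr fun e => ?_
    rw [densityStep]; ring
  · exact (((measurable_heightLaw_Iio.comp measurable_height).pow_const _).mul
      ((measurable_lintegral_add_mul hg r).comp measurable_height)).mul
      (hφ.comp (measurable_chain n))

lemma measurable_iterate_densityStep (n : ℕ) : Measurable ((densityStep k α)^[n] 1) := by
  induction n with
  | zero => exact measurable_one
  | succ n ih =>
    rw [Function.iterate_succ_apply']
    exact measurable_densityStep ih

/-- The induction closes because an arbitrary weight `g` of the height is carried along: each step
replaces `g` by `densityStep k α g` and shortens the chain by one. -/
lemma map_chain_eq_withDensity (hk : 2 ≤ k) (hr : (k : ℝ) ^ α < 1) (n : ℕ) :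
    (lifetimeLaw k).map (chain α n) =
      (heightLaw k α).withDensity ((densityStep k α)^[n] 1) := by
  have key : ∀ (g φ : ℝ → ℝ≥0∞), Measurable g → Measurable φ →
      ∫⁻ e : List (Fin k) → ℝ, g (height α e) * φ (chain α n e) ∂(lifetimeLaw k) =
      ∫⁻ e : List (Fin k) → ℝ, (densityStep k α)^[n] g (height α e) * φ (height α e)
        ∂(lifetimeLaw k) := by
    induction n with
    | zero => intro g φ _ _; rfl
    | succ n ih =>
      intro g φ hg hφ
      rw [lintegral_height_mul_chain_succ hk hr n hg hφ, ih _ _ (measurable_densityStep hg) hφ,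
        ← Function.iterate_succ_apply]
  ext B hB
  have h1 := key 1 (B.indicator 1) measurable_one (measurable_one.indicator hB)
  simp only [Pi.one_apply, one_mul] at h1
  rw [withDensity_apply _ hB, ← lintegral_indicator_one hB,
    lintegral_map (measurable_one.indicator hB) (measurable_chain n), h1,
    ← lintegral_indicator hB, heightLaw,
    lintegral_map ((measurable_iterate_densityStep n).indicator hB) measurable_height]
  refine lintegral_congr fun e => ?_
  by_cases he : height α e ∈ B <;> simp [he]

/-- The laws of the chain satisfy the Kolmogorov equation. -/
lemma map_chain_succ (hk : 2 ≤ k) (hr : (k : ℝ) ^ α < 1) (n : ℕ) :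
    (lifetimeLaw k).map (chain α (n + 1)) = ((lifetimeLaw k).map (chain α n)).bind
      (truncKernel (transitionMeasure k α) ((k : ℝ) ^ α)⁻¹) := by
  have hk' : (0 : ℝ) < k := by positivity
  have hnull := nullSingletonClass_heightLaw hk hr
  have hfin := isFiniteMeasure_transitionMeasure hk hr
  rw [map_chain_eq_withDensity hk hr, map_chain_eq_withDensity hk hr,
    Function.iterate_succ_apply']
  set r := (k : ℝ) ^ α with hrdef
  have hr0 : 0 < r := by positivity
  set g := (densityStep k α)^[n] 1 with hg
  have hgm : Measurable g := measurable_iterate_densityStep n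
  set ν := transitionMeasure k α with hν
  ext B hB
  have hker := measurable_truncKernel ν (show 0 < r⁻¹ by positivity)
  have hkerB : Measurable fun x => truncKernel ν r⁻¹ x B :=
    (Measure.measurable_coe hB).comp hker
  have hfm : Measurable fun x => ENNReal.ofReal (heightDensity k α x) :=
    (continuous_heightDensity hk hr).measurable.ennreal_ofReal
  have hem : Measurable fun x : ℝ => ENNReal.ofReal (Real.exp (-x)) := by fun_prop
  rw [Measure.bind_apply hB hker.aemeasurable,
    lintegral_withDensity_eq_lintegral_mul _ hgm hkerB]
  -- The density `f x` of the height law cancels against the normalisation `exp x * f x` of the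
  -- kernel and leaves `exp (-x)`. The truncation `y < x / r` is rewritten as `x > r * y`, ready for
  -- the exchange of integrals.
  have hR : ∫⁻ x, (g * fun x => truncKernel ν r⁻¹ x B) x ∂(heightLaw k α) =
      ∫⁻ x in Ioi 0, ∫⁻ y in B, (Ioi (r * y)).indicator
        (fun x => ENNReal.ofReal (Real.exp (-x)) * g x) x ∂ν := by
    rw [heightLaw_eq_withDensity hk hr,
      lintegral_withDensity_eq_lintegral_mul _ hfm (hgm.mul hkerB),
      ← lintegral_indicator measurableSet_Ioi]
    refine lintegral_congr fun x => ?_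
    by_cases hx : 0 < x
    · rw [indicator_of_mem (show x ∈ Ioi 0 from hx)]
      have hind : ∀ y, (Ioi (r * y)).indicator
          (fun x => ENNReal.ofReal (Real.exp (-x)) * g x) x =
          (Iio (r⁻¹ * x)).indicator (fun _ => ENNReal.ofReal (Real.exp (-x)) * g x) y := by
        intro y
        have : x ∈ Ioi (r * y) ↔ y ∈ Iio (r⁻¹ * x) := by
          rw [mem_Ioi, mem_Iio, inv_mul_eq_div, lt_div_iff₀ hr0, mul_comm]
        by_cases h : y ∈ Iio (r⁻¹ * x)
        · rw [indicator_of_mem h, indicator_of_mem (this.2 h)]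
        · rw [indicator_of_notMem h, indicator_of_notMem fun h' => h (this.1 h')]
      simp_rw [hind]
      rw [lintegral_indicator_const measurableSet_Iio, Measure.restrict_apply measurableSet_Iio,
        inter_comm, Pi.mul_apply, Pi.mul_apply, truncKernel_apply _ _ _ hB,
        transitionMeasure_Iio hk hr]
      have hf := heightDensity_pos hk hr hx
      have hcancel : ENNReal.ofReal (heightDensity k α x) *
          (ENNReal.ofReal (Real.exp x * heightDensity k α x))⁻¹ =
          ENNReal.ofReal (Real.exp (-x)) := by
        rw [← ENNReal.ofReal_inv_of_pos (by positivity), ← ENNReal.ofReal_mul hf.le,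
          Real.exp_neg]
        congr 1; field_simp
      rw [← hcancel]; ring
    · rw [indicator_of_notMem (show x ∉ Ioi 0 from hx), Pi.mul_apply,
        heightDensity_of_nonpos hk hr (not_lt.1 hx), ENNReal.ofReal_zero, zero_mul]
  rw [hR, lintegral_lintegral_swap]
  · rw [withDensity_apply _ hB, hν, transitionMeasure, restrict_withDensity hB,
      lintegral_withDensity_eq_lintegral_mul _
        (continuous_weight hk hr).measurable.ennreal_ofReal]
    · have hpos : ∀ᵐ y ∂((heightLaw k α).restrict B), 0 < y := by
        refine ae_restrict_of_ae ?_
        have h := measure_eq_zero_iff_ae_notMem.1 (heightLaw_Iic_zero (α := α) hk hr)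
        filter_upwards [h] with y hy using not_le.1 hy
      refine lintegral_congr_ae ?_
      filter_upwards [hpos] with y hy
      have hry : 0 < r * y := mul_pos hr0 hy
      -- The substitution `x = t + r * y` turns the restricted integral into one against the
      -- exponential law; its factor `exp (-(r * y))` cancels the exponential in `weight`.
      have h1 : ∫⁻ x in Ioi 0, (Ioi (r * y)).indicator
          (fun x => ENNReal.ofReal (Real.exp (-x)) * g x) x =
          ENNReal.ofReal (Real.exp (-(r * y))) * ∫⁻ t, g (t + r * y) ∂(expMeasure 1) := by
        have hgm' : Measurable fun t => g (t + r * y) := hgm.comp (measurable_id.add_const _)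
        have heg : Measurable fun t => ENNReal.ofReal (Real.exp (-t)) * g (t + r * y) :=
          hem.mul hgm'
        rw [lintegral_expMeasure hgm', ← lintegral_const_mul _ heg,
          ← lintegral_indicator measurableSet_Ioi, ← lintegral_indicator measurableSet_Ioi,
          ← lintegral_add_right_eq_self _ (r * y)]
        refine lintegral_congr fun t => ?_
        by_cases ht : 0 < t
        · rw [indicator_of_mem (show t ∈ Ioi 0 from ht),
            indicator_of_mem (show t + r * y ∈ Ioi 0 from add_pos ht hry),
            indicator_of_mem (show t + r * y ∈ Ioi (r * y) from lt_add_of_pos_left _ ht),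
            ← mul_assoc, ← ENNReal.ofReal_mul (Real.exp_nonneg _), ← Real.exp_add]
          congr 3; ring
        · rw [indicator_of_notMem (show t ∉ Ioi 0 from ht)]
          refine indicator_apply_eq_zero.2 fun _ => indicator_of_notMem ?_ _
          simpa using ht
      rw [Pi.mul_apply, h1, densityStep, ← mul_assoc]
      congr 1
      rw [measure_congr Iio_ae_eq_Iic, ← ofReal_cdf, ← ENNReal.ofReal_mul (weight_nonneg y),
        weight, ← ENNReal.ofReal_pow (cdf_nonneg _ _), ← ENNReal.ofReal_natCast,
        ← ENNReal.ofReal_mul (by positivity)]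
      congr 1
      have : Real.exp (r * y) * Real.exp (-(r * y)) = 1 := by rw [← Real.exp_add]; simp
      linear_combination (-(k : ℝ) * cdf (heightLaw k α) y ^ (k - 1)) * this
    · have : Measurable fun p : ℝ × ℝ => (Ioi (r * p.1)).indicator
          (fun x => ENNReal.ofReal (Real.exp (-x)) * g x) p.2 := by
        have h2 : Measurable fun p : ℝ × ℝ => ENNReal.ofReal (Real.exp (-p.2)) * g p.2 :=
          (hem.mul hgm).comp measurable_snd
        exact h2.indicator (measurableSet_lt (measurable_fst.const_mul r) measurable_snd)
      exact this.lintegral_prod_right'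
  · have : Measurable fun p : ℝ × ℝ => (Ioi (r * p.2)).indicator
        (fun x => ENNReal.ofReal (Real.exp (-x)) * g x) p.1 := by
      have h2 : Measurable fun p : ℝ × ℝ => ENNReal.ofReal (Real.exp (-p.1)) * g p.1 :=
        (hem.mul hgm).comp measurable_fst
      exact h2.indicator (measurableSet_lt (measurable_snd.const_mul r) measurable_fst)
    exact this.aemeasurable

/-- The height of the first child has the law of `ζ` and is at most the height of the last child,
which is `Z_1`. -/
lemma stochLE_map_chain_zero_one (hk : 2 ≤ k) (hr : (k : ℝ) ^ α < 1) :
    StochLE ((lifetimeLaw k).map (chain α 0)) ((lifetimeLaw k).map (chain α 1)) := by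
  have hk0 : 0 < k := by omega
  intro t
  rw [Measure.map_apply (measurable_chain 0) measurableSet_Ioi,
    Measure.map_apply (measurable_chain 1) measurableSet_Ioi,
    ← (measurePreserving_shift [⟨0, hk0⟩]).measure_preimage
      ((measurable_chain 0) measurableSet_Ioi).nullMeasurableSet]
  refine measure_mono_ae ?_
  filter_upwards [ae_generic hk hr] with e he h
  change t < chain α 1 e
  rw [he.chain_succ hk0]
  exact lt_of_lt_of_le (show t < height α (shift e [⟨0, hk0⟩]) from h)
    (le_height_lastChild hk0 e _)

/-- The chain is stochastically increasing and converges to its unique stationary law. -/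
theorem exists_stationary_chain (hk : 2 ≤ k) (hr : (k : ℝ) ^ α < 1) :
    (∀ m n, m ≤ n → StochLE ((lifetimeLaw k).map (chain α m)) ((lifetimeLaw k).map (chain α n))) ∧
    ∃ π : Measure ℝ, IsProbabilityMeasure π ∧
      IsStationaryLaw k α (cdf (heightLaw k α)) π ∧
      (∀ π', IsStationaryLaw k α (cdf (heightLaw k α)) π' → π' = π) ∧
      ∀ t, π (Ioi t) = ⨆ n, (lifetimeLaw k).map (chain α n) (Ioi t) := by
  have hk' : (0 : ℝ) < k := by positivity
  have hfin := isFiniteMeasure_transitionMeasure hk hr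
  have hc : 0 < ((k : ℝ) ^ α)⁻¹ := by positivity
  have hpos : ∀ s, 0 < s → transitionMeasure k α (Iio s) ≠ 0 :=
    fun s hs => transitionMeasure_Iio_ne_zero hk hr hs
  have hprob : ∀ n, IsProbabilityMeasure ((lifetimeLaw k).map (chain α n)) := fun n =>
    Measure.isProbabilityMeasure_map (measurable_chain n).aemeasurable
  obtain ⟨hmono, π, hπ, hπ0, hstat, hsup⟩ := exists_stationary_of_stochLE
    (transitionMeasure_Iic_zero hk hr) hpos hc
    (μ := fun n => (lifetimeLaw k).map (chain α n))
    (heightLaw_Iic_zero hk hr) (map_chain_succ hk hr) (stochLE_map_chain_zero_one hk hr)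
  refine ⟨hmono, π, hπ, (isStationaryLaw_iff hk hr π).2 ⟨hπ, hπ0, hstat⟩, fun π' hπ' => ?_, hsup⟩
  obtain ⟨h1, h2, h3⟩ := (isStationaryLaw_iff hk hr π').1 hπ'
  exact eq_of_bind_truncKernel_eq hpos hc h2 hπ0 h3 hstat

end

end KAryFragmentation

/-! ### Transfer to an arbitrary probability space -/

namespace KAryFragmentation

lemma rpow_lt_one_of_two_le {k : ℕ} (hk : 2 ≤ k) {α : ℝ} (hα : α < 0) : (k : ℝ) ^ α < 1 :=
  Real.rpow_lt_one_of_one_lt_of_neg (by exact_mod_cast hk) hα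

section

variable {Ω : Type*} [MeasurableSpace Ω] {μ : Measure Ω} {k : ℕ} {α : ℝ}
  {E : List (Fin k) → Ω → ℝ}

lemma hasLaw_lifetimeLaw (hE_indep : iIndepFun E μ) (hE_law : ∀ v, HasLaw (E v) (expMeasure 1) μ) :
    HasLaw (fun ω v => E v ω) (lifetimeLaw k) μ :=
  hE_indep.hasLaw_infinitePi hE_law (aemeasurable_pi_iff.2 fun v => (hE_law v).aemeasurable)

lemma ae_generic_of_hasLaw (hk : 2 ≤ k) (hα : α < 0)
    (hE : HasLaw (fun ω v => E v ω) (lifetimeLaw k) μ) :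
    ∀ᵐ ω ∂μ, Generic α fun v => E v ω := by
  have h := ae_generic hk (rpow_lt_one_of_two_le hk hα)
  rw [← hE.map_eq] at h
  exact ae_of_ae_map hE.aemeasurable h

lemma hasLaw_extinctionTime (hk : 2 ≤ k) (hα : α < 0)
    (hE : HasLaw (fun ω v => E v ω) (lifetimeLaw k) μ) :
    HasLaw (fun ω => extinctionTime α fun v => E v ω) (heightLaw k α) μ := by
  have h : HasLaw (height α) (heightLaw k α) (lifetimeLaw k) :=
    ⟨measurable_height.aemeasurable, rfl⟩
  refine (h.comp hE).congr ?_
  filter_upwards [ae_generic_of_hasLaw hk hα hE] with ω hω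
  exact extinctionTime_eq_height (by omega) (rpow_lt_one_of_two_le hk hα) hω.toRegular

lemma hasLaw_Zseq (hk : 2 ≤ k) (hα : α < 0)
    (hE : HasLaw (fun ω v => E v ω) (lifetimeLaw k) μ) (n : ℕ) :
    HasLaw (fun ω => Zseq α (fun v => E v ω) n) ((lifetimeLaw k).map (chain α n)) μ := by
  have h : HasLaw (chain α n) ((lifetimeLaw k).map (chain α n)) (lifetimeLaw k) :=
    ⟨(measurable_chain n).aemeasurable, rfl⟩
  refine (h.comp hE).congr ?_
  filter_upwards [ae_generic_of_hasLaw hk hα hE] with ω hω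
  exact hω.Zseq_eq_chain hk (rpow_lt_one_of_two_le hk hα) n

lemma extinctionCDF_eq (hk : 2 ≤ k) (hα : α < 0)
    (hE : HasLaw (fun ω v => E v ω) (lifetimeLaw k) μ) :
    extinctionCDF μ α E = cdf (heightLaw k α) := by
  funext x
  rw [cdf_eq_real, extinctionCDF, measureReal_def, measureReal_def]
  congr 1
  exact (hasLaw_extinctionTime hk hα hE).measure_eq (p := fun y => y ≤ x) measurableSet_Iic

end

end KAryFragmentation

theorem mainTheorem9 {Ω : Type*} [MeasurableSpace Ω] (μ : Measure Ω) [IsProbabilityMeasure μ]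
    (k : ℕ) (hk : 2 ≤ k) (α : ℝ) (hα : α < 0)
    (E : List (Fin k) → Ω → ℝ) (hE_indep : iIndepFun E μ)
    (hE_law : ∀ v, HasLaw (E v) (expMeasure 1) μ) :
    let ζ : Ω → ℝ := fun ω => KAryFragmentation.extinctionTime α (fun v => E v ω)
    let Z : ℕ → Ω → ℝ := fun n ω => KAryFragmentation.Zseq α (fun v => E v ω) n
    AEMeasurable ζ μ ∧ (∀ n, AEMeasurable (Z n) μ) ∧
    (∀ m n, m ≤ n → KAryFragmentation.StochLE (μ.map (Z m)) (μ.map (Z n))) ∧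
    ∃ (π : Measure ℝ) (_ : IsProbabilityMeasure π),
      KAryFragmentation.IsStationaryLaw k α (KAryFragmentation.extinctionCDF μ α E) π ∧
      (∀ π' : Measure ℝ,
        KAryFragmentation.IsStationaryLaw k α (KAryFragmentation.extinctionCDF μ α E) π' →
          π' = π) ∧
      TendstoInDistribution Z atTop id (fun _ => μ) π ∧
      KAryFragmentation.StochLE (μ.map ζ) π := by
  intro ζ Z
  have hE := KAryFragmentation.hasLaw_lifetimeLaw hE_indep hE_law
  have hζ : HasLaw ζ _ μ := KAryFragmentation.hasLaw_extinctionTime hk hα hE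
  have hZ : ∀ n, HasLaw (Z n) _ μ := fun n => KAryFragmentation.hasLaw_Zseq hk hα hE n
  obtain ⟨hmono, π, hπ, hstat, huniq, hsup⟩ :=
    KAryFragmentation.exists_stationary_chain hk (KAryFragmentation.rpow_lt_one_of_two_le hk hα)
  rw [KAryFragmentation.extinctionCDF_eq hk hα hE]
  refine ⟨hζ.aemeasurable, fun n => (hZ n).aemeasurable, fun m n hmn => ?_, π, hπ, hstat, huniq,
    ⟨fun n => (hZ n).aemeasurable, aemeasurable_id, ?_⟩, fun t => ?_⟩
  · rw [(hZ m).map_eq, (hZ n).map_eq]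
    exact hmono m n hmn
  -- Each tail is nondecreasing in `n`, so it converges to its supremum, the tail of `π`.
  · refine KAryFragmentation.tendsto_probabilityMeasure_of_tendsto_Ioi fun t => ?_
    simp only [ProbabilityMeasure.coe_mk, Measure.map_id, (hZ _).map_eq, hsup]
    exact tendsto_atTop_iSup fun m n hmn => hmono m n hmn t
  -- The law of `ζ` is that of `Z_0`, so its tail is the term `n = 0` of the supremum.
  · rw [hζ.map_eq, hsup]
    exact le_iSup (fun n =>
      (KAryFragmentation.lifetimeLaw k).map (KAryFragmentation.chain α n) (Set.Ioi t)) 0
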